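/- Let $N,n\ge 1$ be integers, let $A$ be a real $N\times n$ matrix and let $\sigma_{ij}$ ($1\le i\le N$, $1\le j\le n$) be real numbers. Put $D_j=\mathrm{diag}(\sigma_{ij}^2;\,1\le i\le N)$ and $\tilde D_i=\mathrm{diag}(\sigma_{ij}^2;\,1\le j\le n)$. Let $\mathbb R^+=[0,\infty)$ and let $\mathcal S(\mathbb R^+)$ be the set of functions $f(z)=\int_{\mathbb R^+}\frac{\mu(d\lambda)}{\lambda-z}$, $z\in\mathbb C-\mathbb R^+$, where $\mu$ is a probability measure on $\mathbb R^+$. The system of $N+n$ equations, for $z\in\mathbb C-\mathbb R^+$, $$\psi_i(z)=\frac{-1}{z\left(1+\frac1n\mathrm{Tr}\,\tilde D_i\tilde T(z)\right)}\quad(1\le i\le N),\qquad \tilde\psi_j(z)=\frac{-1}{z\left(1+\frac1n\mathrm{Tr}\,D_jT(z)\right)}\quad(1\le j\le n),$$ where $$\Psi(z)=\mathrm{diag}(\psi_i(z);1\le i\le N),\qquad \tilde\Psi(z)=\mathrm{diag}(\tilde\psi_j(z);1\le j\le n),$$ $$T(z)=\left(\Psi(z)^{-1}-zA\tilde\Psi(z)A^T\right)^{-1},\qquad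 \tilde T(z)=\left(\tilde\Psi(z)^{-1}-zA^T\Psi(z)A\right)^{-1},$$ admits a unique solution $(\psi_1,\dots,\psi_N,\tilde\psi_1,\dots,\tilde\psi_n)$ in $\mathcal S(\mathbb R^+)^{N+n}$, and for this solution all the inverses above exist for every $z\in\mathbb C-\mathbb R^+$. Moreover, for this solution there exist a positive $N\times N$ matrix-valued measure $\mu$ and a positive $n\times n$ matrix-valued measure $\tilde\mu$ on $\mathbb R^+$ (that is, matrices of complex Borel measures whose value on every Borel set is a Hermitian positive semidefinite matrix) such that $$\mu(\mathbb R^+)=I_N,\quad \tilde\mu(\mathbb R^+)=I_n,\quad T(z)=\int_{\mathbb R^+}\frac{\mu(d\lambda)}{\lambda-z},\quad \tilde T(z)=\int_{\mathbb R^+}\frac{\tilde\mu(d\lambda)}{\lambda-z}\qquad\text{for all } z\in\mathbb C-\mathbb R^+.$$ In particular, $\frac1N\mathrm{Tr}\,T(z)$ and $\frac1n\mathrm{Tr}\,\tilde T(z)$ belong to $\mathcal S(\mathbb R^+)$. -/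

import Mathlib

open scoped NNReal ComplexOrder

namespace DetEquiv

noncomputable section

/-- The domain `ℂ - ℝ⁺`, where `ℝ⁺ = [0, ∞)`. -/
def cutPlane : Set ℂ := ((fun x : ℝ => (x : ℂ)) '' Set.Ici 0)ᶜ

/-- The class `𝓢(ℝ⁺)` of Stieltjes transforms `z ↦ ∫ μ(dx) / (x - z)`, `z ∈ ℂ - ℝ⁺`,
of probability measures `μ` on `ℝ⁺`. -/
def StieltjesClass : Set (cutPlane → ℂ) :=
  {f | ∃ μ : MeasureTheory.Measure ℝ≥0, MeasureTheory.IsProbabilityMeasure μ ∧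
    ∀ z : cutPlane, f z = ∫ x : ℝ≥0, 1 / (((x : ℝ) : ℂ) - (z : ℂ)) ∂μ}

/-- A matrix-valued measure on the Borel sets of `ℝ⁺`: a matrix of complex measures. -/
abbrev MatrixMeasure (k : ℕ) : Type :=
  Matrix (Fin k) (Fin k) (MeasureTheory.ComplexMeasure ℝ≥0)

/-- The value `μ(s)`, a complex matrix, of a matrix-valued measure on a set `s`. -/
def MatrixMeasure.eval {k : ℕ} (μ : MatrixMeasure k) (s : Set ℝ≥0) :
    Matrix (Fin k) (Fin k) ℂ :=
  Matrix.of fun i j => μ i j s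

/-- A matrix-valued measure is positive if all its values on Borel sets are Hermitian positive
semidefinite matrices. -/
def MatrixMeasure.IsPositive {k : ℕ} (μ : MatrixMeasure k) : Prop :=
  ∀ s : Set ℝ≥0, MeasurableSet s → (μ.eval s).PosSemidef

/-- `F(z) = ∫ μ(dx) / (x - z)` for all `z ∈ ℂ - ℝ⁺`, entry by entry: the integrals of the complex
function `1 / (x - z)` against the complex measures `μ i j` (with respect to the product of `ℂ`)
converge absolutely and equal `F z i j`. -/
def MatrixMeasure.IsStieltjesTransform {k : ℕ} (μ : MatrixMeasure k)
    (F : cutPlane → Matrix (Fin k) (Fin k) ℂ) : Prop :=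
  ∀ (z : cutPlane) (i j : Fin k),
    (μ i j).Integrable (fun x : ℝ≥0 => 1 / (((x : ℝ) : ℂ) - (z : ℂ))) ∧
    F z i j = (μ i j).integral (fun x : ℝ≥0 => 1 / (((x : ℝ) : ℂ) - (z : ℂ)))
      (ContinuousLinearMap.mul ℝ ℂ)

variable {N n : ℕ}

/-- `D_j = diag(σ_{ij}², 1 ≤ i ≤ N)`, as a complex matrix. -/
def colProfile (σ : Fin N → Fin n → ℝ) (j : Fin n) : Matrix (Fin N) (Fin N) ℂ :=
  Matrix.diagonal fun i => ((σ i j ^ 2 : ℝ) : ℂ)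

/-- `D̃_i = diag(σ_{ij}², 1 ≤ j ≤ n)`, as a complex matrix. -/
def rowProfile (σ : Fin N → Fin n → ℝ) (i : Fin N) : Matrix (Fin n) (Fin n) ℂ :=
  Matrix.diagonal fun j => ((σ i j ^ 2 : ℝ) : ℂ)

/-- `Ψ(z) = diag(ψ_i(z))`. -/
def diagFun {k : ℕ} (ψ : Fin k → cutPlane → ℂ) (z : cutPlane) : Matrix (Fin k) (Fin k) ℂ :=
  Matrix.diagonal fun i => ψ i z

/-- A real matrix seen as a complex one. -/
def toComplex (A : Matrix (Fin N) (Fin n) ℝ) : Matrix (Fin N) (Fin n) ℂ :=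
  A.map fun x : ℝ => (x : ℂ)

/-- The matrix `Ψ(z)⁻¹ - z A Ψ̃(z) Aᵀ`, of which `T(z)` is the inverse. With the arguments
`Aᵀ`, `ψ̃`, `ψ` this is `Ψ̃(z)⁻¹ - z Aᵀ Ψ(z) A`, of which `T̃(z)` is the inverse. -/
def preT (A : Matrix (Fin N) (Fin n) ℝ) (ψ : Fin N → cutPlane → ℂ) (ψt : Fin n → cutPlane → ℂ)
    (z : cutPlane) : Matrix (Fin N) (Fin N) ℂ :=
  (diagFun ψ z)⁻¹ - (z : ℂ) • (toComplex A * diagFun ψt z * (toComplex A).transpose)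

/-- `T(z) = (Ψ(z)⁻¹ - z A Ψ̃(z) Aᵀ)⁻¹`. -/
def matT (A : Matrix (Fin N) (Fin n) ℝ) (ψ : Fin N → cutPlane → ℂ) (ψt : Fin n → cutPlane → ℂ)
    (z : cutPlane) : Matrix (Fin N) (Fin N) ℂ :=
  (preT A ψ ψt z)⁻¹

/-- `T̃(z) = (Ψ̃(z)⁻¹ - z Aᵀ Ψ(z) A)⁻¹`. -/
def matTt (A : Matrix (Fin N) (Fin n) ℝ) (ψ : Fin N → cutPlane → ℂ) (ψt : Fin n → cutPlane → ℂ)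
    (z : cutPlane) : Matrix (Fin n) (Fin n) ℂ :=
  (preT A.transpose ψt ψ z)⁻¹

/-- The denominator `z (1 + (1/n) Tr D̃_i T̃(z))`. -/
def rowDenom (σ : Fin N → Fin n → ℝ) (A : Matrix (Fin N) (Fin n) ℝ)
    (ψ : Fin N → cutPlane → ℂ) (ψt : Fin n → cutPlane → ℂ) (i : Fin N) (z : cutPlane) : ℂ :=
  (z : ℂ) * (1 + (1 / (n : ℂ)) * (rowProfile σ i * matTt A ψ ψt z).trace)

/-- The denominator `z (1 + (1/n) Tr D_j T(z))`. -/
def colDenom (σ : Fin N → Fin n → ℝ) (A : Matrix (Fin N) (Fin n) ℝ)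
    (ψ : Fin N → cutPlane → ℂ) (ψt : Fin n → cutPlane → ℂ) (j : Fin n) (z : cutPlane) : ℂ :=
  (z : ℂ) * (1 + (1 / (n : ℂ)) * (colProfile σ j * matT A ψ ψt z).trace)

/-- `(ψ, ψ̃)` is a solution in `𝓢(ℝ⁺)^(N+n)` of the system of `N + n` equations. -/
structure IsSolution (σ : Fin N → Fin n → ℝ) (A : Matrix (Fin N) (Fin n) ℝ)
    (ψ : Fin N → cutPlane → ℂ) (ψt : Fin n → cutPlane → ℂ) : Prop where
  mem_row : ∀ i, ψ i ∈ StieltjesClass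
  mem_col : ∀ j, ψt j ∈ StieltjesClass
  eq_row : ∀ i z, ψ i z = -1 / rowDenom σ A ψ ψt i z
  eq_col : ∀ j z, ψt j z = -1 / colDenom σ A ψ ψt j z

/-- All the inverses and quotients in the system exist at every point of `ℂ - ℝ⁺`. -/
structure IsWellDefined (σ : Fin N → Fin n → ℝ) (A : Matrix (Fin N) (Fin n) ℝ)
    (ψ : Fin N → cutPlane → ℂ) (ψt : Fin n → cutPlane → ℂ) : Prop where
  row_ne : ∀ i z, ψ i z ≠ 0
  col_ne : ∀ j z, ψt j z ≠ 0
  unit_T : ∀ z, IsUnit (preT A ψ ψt z).det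
  unit_Tt : ∀ z, IsUnit (preT A.transpose ψt ψ z).det
  rowDenom_ne : ∀ i z, rowDenom σ A ψ ψt i z ≠ 0
  colDenom_ne : ∀ j z, colDenom σ A ψ ψt j z ≠ 0

end

end DetEquiv

namespace DetEquiv

noncomputable section

open Filter Topology

/-! ### Perturbation bounds for inverses of `t (1 + G)` -/

section Resolvent

variable {R : Type*} [NormedRing R] [NormedAlgebra ℝ R] [NormOneClass R]

/-! Put X = diag(T, T̃, Ψ, Ψ̃). Since -z(1 + (1/n) Tr D̃_i T̃) = ψ_i⁻¹, and likewise for ψ̃_j, the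
whole system is the single equation X(z) · (-z)(1 + η(diag X(z))) = 1, where η (`systemMap`) is
linear and sends nonnegative vectors to positive semidefinite matrices. Keeping Ψ and Ψ̃ as blocks
beside T and T̃ is what makes η linear.

Existence. Iterate F ↦ (-z(1 + η(diag F)))⁻¹ from F₀ = (-z)⁻¹. If F is the transform of a finitely
atomic positive matrix measure, then η(diag F) = B(Λ - z)⁻¹Bᴴ, and by a Schur complement the next
iterate is a corner of the resolvent of a positive semidefinite matrix
(`exists_atomicTransform_mul_eq_one`). So it is again such a transform, of mass 1 and first moment
η(1). The fixed first moment gives tightness, hence an ultrafilter limit X that is the transform of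
a positive matrix measure of mass 1 (`exists_ultrafilter_limit`). At z = -t with t large the
iteration contracts, so increments vanish and the equation passes to the limit. Both of its sides
are holomorphic on the connected cut plane, and the identity theorem extends it to all z
(`exists_represents_fixedPoint`).

Uniqueness. For any solution, ψ_i(-t) and ψ̃_j(-t) are nonzero of modulus at most 1/t, which forces
T(-t) and T̃(-t) to exist for large t and to tend to 0. Two solutions thus give two small solutions
of one fixed point equation. They agree for large t by contraction, hence ψ and ψ̃ agree everywhere.
Every solution is therefore the constructed one and inherits its invertibility and its measures. -/

theorem norm_le_of_mul_one_add_eq_one {X G : R} {t : ℝ} (ht : 0 < t) (hG : ‖G‖ ≤ 1 / 2)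
    (h : X * (t • (1 + G)) = 1) : ‖X‖ ≤ 2 / t := by
  have h1 : t • X = 1 - t • X * G := by
    rw [← h]; simp only [mul_smul_comm, mul_add, mul_one, smul_add, smul_mul_assoc]; abel
  have h2 : ‖t • X‖ ≤ 1 + ‖t • X‖ * (1 / 2) := by
    calc ‖t • X‖ = ‖1 - t • X * G‖ := by rw [← h1]
      _ ≤ ‖(1 : R)‖ + ‖t • X * G‖ := norm_sub_le _ _
      _ ≤ 1 + ‖t • X‖ * (1 / 2) := by
        rw [norm_one]
        gcongr
        exact (norm_mul_le _ _).trans (by gcongr)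
  rw [norm_smul, Real.norm_of_nonneg ht.le] at h2
  rw [le_div_iff₀ ht]
  linarith

/-- Resolvent identity: the difference is `t • (X * (K - G) * Y)`, and `X`, `Y` have norm at most `2
/ t` each. -/
theorem norm_sub_le_of_mul_one_add_eq_one {X Y G K : R} {t : ℝ} (ht : 0 < t)
    (hG : ‖G‖ ≤ 1 / 2) (hK : ‖K‖ ≤ 1 / 2)
    (hX : X * (t • (1 + G)) = 1) (hY : Y * (t • (1 + K)) = 1) (hY' : (t • (1 + K)) * Y = 1) :
    ‖X - Y‖ ≤ 4 / t * ‖G - K‖ := by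
  have h1 : X - Y = t • (X * (K - G) * Y) := by
    have e : t • (K - G) = t • (1 + K) - t • (1 + G) := by
      rw [← smul_sub]; congr 1; abel
    calc X - Y = X * ((t • (1 + K)) * Y) - (X * (t • (1 + G))) * Y := by
          rw [hX, hY', mul_one, one_mul]
      _ = X * (t • (K - G)) * Y := by rw [e]; simp only [mul_sub, sub_mul, mul_assoc]
      _ = t • (X * (K - G) * Y) := by simp only [mul_smul_comm, smul_mul_assoc]
  have hx := norm_le_of_mul_one_add_eq_one ht hG hX
  have hy := norm_le_of_mul_one_add_eq_one ht hK hY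
  rw [h1, norm_smul, Real.norm_of_nonneg ht.le]
  calc t * ‖X * (K - G) * Y‖ ≤ t * (2 / t * ‖K - G‖ * (2 / t)) := by
        gcongr
        refine (norm_mul_le _ _).trans ?_
        gcongr
        exact (norm_mul_le _ _).trans (by gcongr)
    _ = 4 / t * ‖G - K‖ := by
        rw [norm_sub_rev]; field_simp; ring

end Resolvent

/-! ### Contraction of the fixed point map for large `t` -/

section Matrix

variable {ι : Type*} [Fintype ι] [DecidableEq ι]

-- This norm is submultiplicative, gives the identity norm 1 on a nonempty index type, and induces
-- entrywise convergence.
attribute [local instance] Matrix.linftyOpNormedRing Matrix.linftyOpNormedAlgebra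

/-- The linear map `X ↦ η (diag X)` on square matrices. -/
def diagLift (η : (ι → ℂ) →ₗ[ℂ] Matrix ι ι ℂ) : Matrix ι ι ℂ →ₗ[ℂ] Matrix ι ι ℂ :=
  η ∘ₗ Matrix.diagLinearMap ι ℂ ℂ

theorem exists_norm_diagLift_le (η : (ι → ℂ) →ₗ[ℂ] Matrix ι ι ℂ) :
    ∃ c : ℝ, 0 < c ∧ ∀ X : Matrix ι ι ℂ, ‖diagLift η X‖ ≤ c * ‖X‖ := by
  obtain ⟨c, hc, h⟩ := (LinearMap.toContinuousLinearMap (diagLift η)).isBoundedLinearMap.bound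
  exact ⟨c, hc, h⟩

/-- Two solutions of `X (t (1 + η (diag X))) = 1` with `η (diag X)` small agree for large `t`. -/
theorem eventually_eq_of_fixedPoint [Nonempty ι] (η : (ι → ℂ) →ₗ[ℂ] Matrix ι ι ℂ)
    (X Y : ℝ → Matrix ι ι ℂ)
    (hX : ∀ᶠ t in atTop, X t * ((t : ℂ) • (1 + η (X t).diag)) = 1)
    (hY : ∀ᶠ t in atTop, Y t * ((t : ℂ) • (1 + η (Y t).diag)) = 1)
    (hX0 : Tendsto X atTop (𝓝 0)) (hY0 : Tendsto Y atTop (𝓝 0)) :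
    ∀ᶠ t in atTop, X t = Y t := by
  obtain ⟨c, hc, hη⟩ := exists_norm_diagLift_le η
  have small : ∀ Z : ℝ → Matrix ι ι ℂ, Tendsto Z atTop (𝓝 0) →
      ∀ᶠ t in atTop, ‖diagLift η (Z t)‖ ≤ 1 / 2 := by
    intro Z hZ
    have h1 : ∀ᶠ t in atTop, ‖Z t‖ < 1 / (2 * c) := by
      have h2 : Tendsto (fun t => ‖Z t‖) atTop (𝓝 0) := by simpa using hZ.norm
      exact h2.eventually_lt_const (by positivity)
    filter_upwards [h1] with t ht
    calc ‖diagLift η (Z t)‖ ≤ c * ‖Z t‖ := hη _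
      _ ≤ c * (1 / (2 * c)) := by gcongr
      _ = 1 / 2 := by field_simp
  -- The threshold `8 * c` makes the Lipschitz factor `4 * c / t` at most `1 / 2`, so the difference
  -- is at most half of itself.
  filter_upwards [hX, hY, small X hX0, small Y hY0, eventually_gt_atTop (8 * c)]
    with t h1 h2 h3 h4 h5
  have ht : 0 < t := by linarith
  have cast : ∀ M : Matrix ι ι ℂ, (t : ℂ) • M = t • M := fun M => by
    ext i j; simp
  rw [cast] at h1 h2
  have h6 := norm_sub_le_of_mul_one_add_eq_one ht h3 h4 h1 h2 (mul_eq_one_comm.mp h2)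
  have h7 : ‖diagLift η (X t) - diagLift η (Y t)‖ ≤ c * ‖X t - Y t‖ := by
    rw [← map_sub]; exact hη _
  have h8 : ‖X t - Y t‖ ≤ 1 / 2 * ‖X t - Y t‖ := by
    calc ‖X t - Y t‖ ≤ 4 / t * (c * ‖X t - Y t‖) := h6.trans (by gcongr)
      _ = (4 * c / t) * ‖X t - Y t‖ := by ring
      _ ≤ 1 / 2 * ‖X t - Y t‖ := by
        refine mul_le_mul_of_nonneg_right ?_ (norm_nonneg _)
        rw [div_le_div_iff₀ ht (by norm_num)]; linarith
  have h9 : ‖X t - Y t‖ = 0 := by linarith [norm_nonneg (X t - Y t)]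
  exact sub_eq_zero.mp (norm_eq_zero.mp h9)

/-- The iterates of `X ↦ (t (1 + η (diag X)))⁻¹` have increments tending to `0` for large `t`. -/
theorem exists_tendsto_iterate_sub [Nonempty ι] (η : (ι → ℂ) →ₗ[ℂ] Matrix ι ι ℂ) :
    ∃ t₀ : ℝ, 0 < t₀ ∧ ∀ (t : ℝ), t₀ < t → ∀ X : ℕ → Matrix ι ι ℂ,
      X 0 = ((t : ℂ)⁻¹) • 1 → (∀ m, X (m + 1) * ((t : ℂ) • (1 + η (X m).diag)) = 1) →
      Tendsto (fun m => X (m + 1) - X m) atTop (𝓝 0) := by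
  obtain ⟨c, hc, hη⟩ := exists_norm_diagLift_le η
  refine ⟨8 * c, by positivity, fun t ht X h0 hs => ?_⟩
  have htp : 0 < t := by linarith
  have cast : ∀ M : Matrix ι ι ℂ, (t : ℂ) • M = t • M := fun M => by
    ext i j; simp
  have hs' : ∀ m, X (m + 1) * (t • (1 + diagLift η (X m))) = 1 := fun m => by
    rw [← cast]; exact hs m
  have half : ∀ Z : Matrix ι ι ℂ, ‖Z‖ ≤ 2 / t → ‖diagLift η Z‖ ≤ 1 / 2 := fun Z hZ => by
    calc ‖diagLift η Z‖ ≤ c * (2 / t) := (hη _).trans (by gcongr)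
      _ ≤ 1 / 2 := by
        rw [← mul_div_assoc, div_le_div_iff₀ htp (by norm_num)]; linarith
  -- The ball of radius `2 / t` contains the starting point and is stable under the iteration.
  have bd : ∀ m, ‖X m‖ ≤ 2 / t := by
    intro m
    induction m with
    | zero =>
      rw [h0, norm_smul, norm_one, norm_inv, Complex.norm_real, Real.norm_of_nonneg htp.le,
        mul_one, inv_eq_one_div]
      gcongr
      norm_num
    | succ m ih => exact norm_le_of_mul_one_add_eq_one htp (half _ ih) (hs' m)
  have step : ∀ m, ‖X (m + 2) - X (m + 1)‖ ≤ 1 / 2 * ‖X (m + 1) - X m‖ := by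
    intro m
    have h6 := norm_sub_le_of_mul_one_add_eq_one htp (half _ (bd (m + 1))) (half _ (bd m))
      (hs' (m + 1)) (hs' m) (mul_eq_one_comm.mp (hs' m))
    have h7 : ‖diagLift η (X (m + 1)) - diagLift η (X m)‖ ≤ c * ‖X (m + 1) - X m‖ := by
      rw [← map_sub]; exact hη _
    calc ‖X (m + 2) - X (m + 1)‖ ≤ 4 / t * (c * ‖X (m + 1) - X m‖) := h6.trans (by gcongr)
      _ = (4 * c / t) * ‖X (m + 1) - X m‖ := by ring
      _ ≤ 1 / 2 * ‖X (m + 1) - X m‖ := by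
        refine mul_le_mul_of_nonneg_right ?_ (norm_nonneg _)
        rw [div_le_div_iff₀ htp (by norm_num)]; linarith
  have geo : ∀ m, ‖X (m + 1) - X m‖ ≤ (1 / 2) ^ m * ‖X 1 - X 0‖ := by
    intro m
    induction m with
    | zero => simp
    | succ m ih =>
      calc _ ≤ 1 / 2 * ‖X (m + 1) - X m‖ := step m
        _ ≤ 1 / 2 * ((1 / 2) ^ m * ‖X 1 - X 0‖) := by gcongr
        _ = _ := by ring
  refine squeeze_zero_norm geo ?_
  have := (tendsto_pow_atTop_nhds_zero_of_lt_one (r := (1 / 2 : ℝ)) (by norm_num)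
    (by norm_num)).mul_const ‖X 1 - X 0‖
  simpa using this

end Matrix

open MeasureTheory Matrix

theorem sub_ne_zero_of_mem_cutPlane {z : ℂ} (hz : z ∈ cutPlane) {x : ℝ} (hx : 0 ≤ x) :
    (x : ℂ) - z ≠ 0 := fun h => hz ⟨x, hx, sub_eq_zero.mp h⟩

theorem ne_zero_of_mem_cutPlane {z : ℂ} (hz : z ∈ cutPlane) : z ≠ 0 := fun h =>
  hz ⟨0, le_refl (0 : ℝ), by simp [h]⟩

/-! ### Realization of the iteration step by a Schur complement -/

section Realization

variable {ι κ : Type*} [Fintype ι] [DecidableEq ι] [Fintype κ] [DecidableEq κ]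

/-- The Stieltjes transform at `z` of the atomic matrix-valued measure `∑ₖ uₖ uₖᴴ δ_{λₖ}`, where
`uₖ` is the `k`-th column of `U`. -/
def atomicTransform (U : Matrix ι κ ℂ) (l : κ → ℝ) (z : ℂ) : Matrix ι ι ℂ :=
  U * diagonal (fun k => ((l k : ℂ) - z)⁻¹) * Uᴴ

omit [Fintype ι] [DecidableEq ι] in
theorem mul_diagonal_mul_conjTranspose_apply (U : Matrix ι κ ℂ) (w : κ → ℂ) (i j : ι) :
    (U * diagonal w * Uᴴ) i j = ∑ k, U i k * w k * star (U j k) := by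
  rw [Matrix.mul_apply]
  simp only [Matrix.mul_diagonal, conjTranspose_apply]

/-- A Schur complement computation. -/
theorem schur_mul_eq_one (B : Matrix ι κ ℂ) (l : κ → ℝ) (hl : ∀ k, 0 ≤ l k) {z : ℂ}
    (hz : z ∈ cutPlane) (R : Matrix (ι ⊕ κ) (ι ⊕ κ) ℂ)
    (hR : (fromBlocks (B * Bᴴ) (B * diagonal fun k => (Real.sqrt (l k) : ℂ))
      ((diagonal fun k => (Real.sqrt (l k) : ℂ)) * Bᴴ) (diagonal fun k => (l k : ℂ)) -
        z • (1 : Matrix (ι ⊕ κ) (ι ⊕ κ) ℂ)) * R = 1) :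
    ((-z) • (1 + atomicTransform B l z)) * R.toBlocks₁₁ = 1 := by
  set S : Matrix κ κ ℂ := diagonal fun k => (Real.sqrt (l k) : ℂ) with hS
  set L : Matrix κ κ ℂ := diagonal fun k => (l k : ℂ) with hL
  set W : Matrix κ κ ℂ := diagonal fun k => ((l k : ℂ) - z)⁻¹ with hW
  have hne : ∀ k, (l k : ℂ) - z ≠ 0 := fun k => sub_ne_zero_of_mem_cutPlane hz (hl k)
  have hWL : W * (L - z • 1) = 1 := by
    rw [hW, hL, ← diagonal_one, ← diagonal_smul, diagonal_sub, diagonal_mul_diagonal]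
    congr 1; ext k; simp [hne k]
  -- Entrywise this is `l / (l - z) = 1 + z / (l - z)`.
  have hSWS : S * W * S = 1 + z • W := by
    rw [hS, hW, diagonal_mul_diagonal, diagonal_mul_diagonal, ← diagonal_one, ← diagonal_smul,
      diagonal_add]
    congr 1; ext k
    have h1 : (Real.sqrt (l k) : ℂ) * (Real.sqrt (l k) : ℂ) = l k := by
      rw [← Complex.ofReal_mul, Real.mul_self_sqrt (hl k)]
    have := hne k
    simp only [Pi.smul_apply, smul_eq_mul]
    calc _ = ((Real.sqrt (l k) : ℂ) * (Real.sqrt (l k) : ℂ)) * ((l k : ℂ) - z)⁻¹ := by ring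
      _ = 1 + z * ((l k : ℂ) - z)⁻¹ := by rw [h1]; field_simp; ring
  rw [← fromBlocks_toBlocks R, ← fromBlocks_one, fromBlocks_smul, sub_eq_add_neg, fromBlocks_neg,
    fromBlocks_add, fromBlocks_multiply, fromBlocks_inj] at hR
  obtain ⟨h11, -, h21, -⟩ := hR
  simp only [smul_zero, neg_zero, add_zero, ← sub_eq_add_neg] at h11 h21
  set R₁ := R.toBlocks₁₁
  set R₂ := R.toBlocks₂₁
  have hR2 : R₂ = - (W * (S * Bᴴ * R₁)) := by
    have : (L - z • 1) * R₂ = - (S * Bᴴ * R₁) := eq_neg_of_add_eq_zero_right h21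
    calc R₂ = W * (L - z • 1) * R₂ := by rw [hWL, Matrix.one_mul]
      _ = _ := by rw [Matrix.mul_assoc, this, Matrix.mul_neg]
  -- Eliminating the lower block produces `-(B * Bᴴ)`, which cancels the upper left block and leaves
  -- `-z (1 + B W Bᴴ)`.
  rw [hR2] at h11
  have e : B * S * -(W * (S * Bᴴ * R₁)) = -((B * Bᴴ) * R₁) - z • (B * W * Bᴴ * R₁) := by
    calc _ = -(B * (S * W * S) * Bᴴ * R₁) := by simp only [Matrix.mul_assoc, Matrix.mul_neg]
      _ = _ := by
        rw [hSWS]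
        simp only [Matrix.mul_add, Matrix.add_mul, Matrix.mul_one, Matrix.mul_smul,
          Matrix.smul_mul, neg_add, sub_eq_add_neg]
  rw [e] at h11
  refine Eq.trans ?_ h11
  rw [atomicTransform, ← hW]
  simp only [Matrix.sub_mul, Matrix.smul_mul, Matrix.add_mul, Matrix.one_mul, smul_add, neg_smul,
    Matrix.neg_mul]
  abel

/-- The function `z ↦ (-z (1 + G(z)))⁻¹`, where `G` is the transform of an atomic positive
matrix-valued measure, is the transform of an atomic positive matrix-valued measure of total mass
`1` whose first moment is the total mass of the first measure. -/
theorem exists_atomicTransform_mul_eq_one (B : Matrix ι κ ℂ) (l : κ → ℝ) (hl : ∀ k, 0 ≤ l k) :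
    ∃ (U : Matrix ι (ι ⊕ κ) ℂ) (m : ι ⊕ κ → ℝ), (∀ k, 0 ≤ m k) ∧ U * Uᴴ = 1 ∧
      U * diagonal (fun k => (m k : ℂ)) * Uᴴ = B * Bᴴ ∧
      ∀ z ∈ cutPlane, atomicTransform U m z * ((-z) • (1 + atomicTransform B l z)) = 1 := by
  set S : Matrix κ κ ℂ := diagonal fun k => (Real.sqrt (l k) : ℂ) with hS
  -- Chosen so that the Gram matrix `Cᴴ * C` has Schur complement `-z (1 + B W Bᴴ)`; being a Gram
  -- matrix, it has spectrum in `[0, ∞)`.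
  set C : Matrix κ (ι ⊕ κ) ℂ := fromCols Bᴴ S with hC
  have hSH : Sᴴ = S := by
    rw [hS, diagonal_conjTranspose]; congr 1; ext k; simp
  have hSS : S * S = diagonal fun k => (l k : ℂ) := by
    rw [hS, diagonal_mul_diagonal]; congr 1; ext k
    rw [← Complex.ofReal_mul, Real.mul_self_sqrt (hl k)]
  have hH : Cᴴ * C = fromBlocks (B * Bᴴ) (B * S) (S * Bᴴ) (diagonal fun k => (l k : ℂ)) := by
    rw [hC, conjTranspose_fromCols_eq_fromRows_conjTranspose, fromRows_mul_fromCols,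
      conjTranspose_conjTranspose, hSH, hSS]
  have hpos : (Cᴴ * C).PosSemidef := posSemidef_conjTranspose_mul_self C
  have hherm := hpos.isHermitian
  set V : Matrix (ι ⊕ κ) (ι ⊕ κ) ℂ := (hherm.eigenvectorUnitary : Matrix (ι ⊕ κ) (ι ⊕ κ) ℂ) with hV
  set m := hherm.eigenvalues with hm
  have hm0 : ∀ k, 0 ≤ m k := hpos.eigenvalues_nonneg
  have hVV : V * Vᴴ = 1 := Unitary.mul_star_self_of_mem hherm.eigenvectorUnitary.2
  have hVV' : Vᴴ * V = 1 := Unitary.star_mul_self_of_mem hherm.eigenvectorUnitary.2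
  have hspec : Cᴴ * C = V * diagonal (fun k => (m k : ℂ)) * Vᴴ := by
    have := hherm.spectral_theorem
    rw [Unitary.conjStarAlgAut_apply] at this
    exact this
  -- The `ι`-rows of the eigenvector matrix compress any function of `Cᴴ * C` to its upper left
  -- corner: the constant 1 gives the mass, the identity function the first moment, the resolvent
  -- the transform.
  set U : Matrix ι (ι ⊕ κ) ℂ := V.submatrix Sum.inl id with hU
  have hblock : ∀ D : Matrix (ι ⊕ κ) (ι ⊕ κ) ℂ, (V * D * Vᴴ).toBlocks₁₁ = U * D * Uᴴ := by
    intro D; ext i j; simp [toBlocks₁₁, hU, Matrix.mul_apply]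
  refine ⟨U, m, hm0, ?_, ?_, fun z hz => ?_⟩
  · have := hblock 1
    rw [Matrix.mul_one, Matrix.mul_one, hVV] at this
    rw [← this]; ext i j; simp [toBlocks₁₁, Matrix.one_apply]
  · rw [← hblock, ← hspec, hH, toBlocks_fromBlocks₁₁]
  · rw [mul_eq_one_comm]
    have hR : (Cᴴ * C - z • (1 : Matrix (ι ⊕ κ) (ι ⊕ κ) ℂ)) *
        (V * diagonal (fun k => ((m k : ℂ) - z)⁻¹) * Vᴴ) = 1 := by
      have h1 : Cᴴ * C - z • (1 : Matrix (ι ⊕ κ) (ι ⊕ κ) ℂ) =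
          V * diagonal (fun k => (m k : ℂ) - z) * Vᴴ := by
        have : (diagonal fun k => (m k : ℂ) - z) =
            diagonal (fun k => (m k : ℂ)) - z • (1 : Matrix (ι ⊕ κ) (ι ⊕ κ) ℂ) := by
          rw [← diagonal_one, ← diagonal_smul, diagonal_sub]; congr 1; ext k; simp
        rw [this, Matrix.mul_sub, Matrix.sub_mul, ← hspec, Matrix.mul_smul, Matrix.smul_mul,
          Matrix.mul_one, hVV]
      rw [h1]
      calc _ = V * (diagonal (fun k => (m k : ℂ) - z) * (Vᴴ * V) *
            diagonal (fun k => ((m k : ℂ) - z)⁻¹)) * Vᴴ := by simp only [Matrix.mul_assoc]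
        _ = 1 := by
          rw [hVV', Matrix.mul_one, diagonal_mul_diagonal]
          have : (fun k => ((m k : ℂ) - z) * ((m k : ℂ) - z)⁻¹) = fun _ => 1 := by
            ext k; exact mul_inv_cancel₀ (sub_ne_zero_of_mem_cutPlane hz (hm0 k))
          rw [this, diagonal_one, Matrix.mul_one, hVV]
    rw [hH] at hR
    have := schur_mul_eq_one B l hl hz _ hR
    rwa [hblock] at this

end Realization

/-! ### The iterates as atomic transforms -/

section Iteration

variable {ι : Type} [Fintype ι] [DecidableEq ι]

/-- `F` is the Stieltjes transform of an atomic positive matrix-valued measure on `ℝ⁺` of total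
mass `1`, the trace of whose first moment is at most `C`. -/
def IsAtomic (C : ℝ) (F : ℂ → Matrix ι ι ℂ) : Prop :=
  ∃ (κ : Type) (_ : Fintype κ) (_ : DecidableEq κ) (U : Matrix ι κ ℂ) (m : κ → ℝ),
    (∀ k, 0 ≤ m k) ∧ U * Uᴴ = 1 ∧ (∑ k, m k * ∑ i, ‖U i k‖ ^ 2 ≤ C) ∧
    ∀ z ∈ cutPlane, F z = atomicTransform U m z

/-- A positive linear map, applied to the diagonal of a matrix. -/
def IsPositiveMap (η : (ι → ℂ) →ₗ[ℂ] Matrix ι ι ℂ) : Prop :=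
  ∀ x : ι → ℂ, 0 ≤ x → (η x).PosSemidef

open scoped MatrixOrder in
theorem _root_.Matrix.PosSemidef.exists_eq_mul_conjTranspose {P : Matrix ι ι ℂ}
    (hP : P.PosSemidef) : ∃ L : Matrix ι ι ℂ, P = L * Lᴴ := by
  obtain ⟨L, rfl⟩ := CStarAlgebra.nonneg_iff_eq_star_mul_self.mp hP.nonneg
  exact ⟨Lᴴ, by rw [conjTranspose_conjTranspose, star_eq_conjTranspose]⟩

omit [DecidableEq ι] in
theorem trace_mul_diagonal_mul_conjTranspose {κ : Type} [Fintype κ] [DecidableEq κ]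
    (U : Matrix ι κ ℂ) (m : κ → ℝ) :
    (U * diagonal (fun k => (m k : ℂ)) * Uᴴ).trace = ((∑ k, m k * ∑ i, ‖U i k‖ ^ 2 : ℝ) : ℂ) := by
  simp only [trace, diag_apply, mul_diagonal_mul_conjTranspose_apply]
  rw [Finset.sum_comm]
  push_cast
  refine Finset.sum_congr rfl fun k _ => ?_
  rw [Finset.mul_sum]
  refine Finset.sum_congr rfl fun i _ => ?_
  rw [← Complex.mul_conj' (U i k)]
  simp only [Complex.star_def]
  ring

theorem map_eq_sum_single (η : (ι → ℂ) →ₗ[ℂ] Matrix ι ι ℂ) (x : ι → ℂ) :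
    η x = ∑ s, x s • η (Pi.single s 1) := by
  conv_lhs => rw [← Finset.univ_sum_single x]
  rw [map_sum]
  refine Finset.sum_congr rfl fun s _ => ?_
  rw [← map_smul, ← Pi.single_smul, smul_eq_mul, mul_one]

/-- Positivity factors each `η (Pi.single s 1)` as `L s * (L s)ᴴ`, so `η (F z).diag` is itself an
atomic transform with the same spectral values as `F`. The new first moment is `η` of the diagonal
of the mass of `F`, that is `η 1`; the bound therefore does not depend on `C` and does not degrade
along the iteration. -/
theorem IsAtomic.step {η : (ι → ℂ) →ₗ[ℂ] Matrix ι ι ℂ} (hη : IsPositiveMap η) {C : ℝ}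
    {F : ℂ → Matrix ι ι ℂ} (hF : IsAtomic C F) :
    ∃ F', IsAtomic (η 1).trace.re F' ∧
      ∀ z ∈ cutPlane, F' z * ((-z) • (1 + η (F z).diag)) = 1 := by
  obtain ⟨κ, _, _, U, m, hm, hU, -, hFU⟩ := hF
  have hL : ∀ s, ∃ L : Matrix ι ι ℂ, η (Pi.single s 1) = L * Lᴴ := fun s => by
    have := hη (Pi.single s 1) (by simp [Pi.single_nonneg])
    exact this.exists_eq_mul_conjTranspose
  choose L hL using hL
  -- The column indexed by `(s, k, a)` is the `a`-th column of `L s` scaled by `U s k`, and sits at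
  -- the atom `m k`.
  set B : Matrix ι (ι × κ × ι) ℂ := Matrix.of fun i p => U p.1 p.2.1 * L p.1 i p.2.2 with hB
  have key : ∀ w : κ → ℂ, B * diagonal (fun p : ι × κ × ι => w p.2.1) * Bᴴ =
      η (U * diagonal w * Uᴴ).diag := by
    intro w
    rw [map_eq_sum_single]
    ext i j
    rw [mul_diagonal_mul_conjTranspose_apply]
    simp only [Matrix.sum_apply, Matrix.smul_apply, hL, diag_apply]
    simp only [mul_diagonal_mul_conjTranspose_apply, hB, of_apply, Fintype.sum_prod_type,
      star_mul', smul_eq_mul]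
    refine Finset.sum_congr rfl fun s _ => ?_
    rw [Finset.sum_mul]
    refine Finset.sum_congr rfl fun k _ => ?_
    rw [Matrix.mul_apply, Finset.mul_sum]
    refine Finset.sum_congr rfl fun a _ => ?_
    rw [conjTranspose_apply]
    ring
  obtain ⟨U', m', hm', hU', hmom, hF'⟩ :=
    exists_atomicTransform_mul_eq_one B (fun p => m p.2.1) (fun p => hm _)
  refine ⟨atomicTransform U' m', ⟨_, inferInstance, inferInstance, U', m', hm', hU', ?_,
    fun z _ => rfl⟩, fun z hz => ?_⟩
  · have h1 := key 1
    have e1 : (diagonal (fun p : ι × κ × ι => (1 : κ → ℂ) p.2.1)) = 1 := diagonal_one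
    have e2 : (diagonal (1 : κ → ℂ)) = 1 := diagonal_one
    rw [e1, e2, Matrix.mul_one, Matrix.mul_one, hU] at h1
    have e3 : (1 : Matrix ι ι ℂ).diag = 1 := by ext; simp
    have h2 := congrArg Matrix.trace (hmom.trans h1)
    rw [trace_mul_diagonal_mul_conjTranspose, e3] at h2
    rw [← h2, Complex.ofReal_re]
  · have h1 : atomicTransform B (fun p => m p.2.1) z = η (F z).diag := by
      rw [hFU z hz]; exact key fun k => ((m k : ℂ) - z)⁻¹
    rw [← h1]
    exact hF' z hz

theorem isAtomic_neg_inv : IsAtomic 0 (fun z => (-z)⁻¹ • (1 : Matrix ι ι ℂ)) := by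
  refine ⟨ι, inferInstance, inferInstance, 1, 0, fun _ => le_rfl, by simp, by simp, fun z _ => ?_⟩
  ext i j
  rw [atomicTransform, mul_diagonal_mul_conjTranspose_apply]
  by_cases h : i = j <;> simp [Matrix.one_apply, h]

theorem exists_atomic_iteration {η : (ι → ℂ) →ₗ[ℂ] Matrix ι ι ℂ} (hη : IsPositiveMap η) :
    ∃ F : ℕ → ℂ → Matrix ι ι ℂ, (∀ z, F 0 z = (-z)⁻¹ • 1) ∧
      (∀ m, IsAtomic (η 1).trace.re (F (m + 1))) ∧
      ∀ m, ∀ z ∈ cutPlane, F (m + 1) z * ((-z) • (1 + η (F m z).diag)) = 1 := by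
  -- The moment bound is quantified existentially so that the same step applies to the start (bound
  -- 0) and to every later iterate.
  choose! nxt hn1 hn2 using fun (F : ℂ → Matrix ι ι ℂ) (h : ∃ C, IsAtomic C F) =>
    (h.choose_spec).step hη
  set F : ℕ → ℂ → Matrix ι ι ℂ := fun m => nxt^[m] (fun z => (-z)⁻¹ • 1) with hF
  have succ : ∀ m, F (m + 1) = nxt (F m) := fun m => Function.iterate_succ_apply' _ _ _
  have at' : ∀ m, ∃ C, IsAtomic C (F m) := by
    intro m
    induction m with
    | zero => exact ⟨0, isAtomic_neg_inv⟩
    | succ m ih => rw [succ]; exact ⟨_, hn1 _ ih⟩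
  refine ⟨F, fun z => rfl, fun m => ?_, fun m z hz => ?_⟩
  · rw [succ]; exact hn1 _ (at' m)
  · rw [succ]; exact hn2 _ (at' m) z hz

end Iteration

/-! ### Topology of the cut plane and the identity theorem -/

section CutPlane

theorem isOpen_cutPlane : IsOpen cutPlane :=
  (Complex.isometry_ofReal.isClosedEmbedding.isClosedMap _ isClosed_Ici).isOpen_compl

theorem cutPlane_eq_neg_image : cutPlane = (fun z : ℂ => -z) '' Complex.slitPlane := by
  ext z
  rw [cutPlane, Set.mem_compl_iff]
  constructor
  · intro h
    refine ⟨-z, ?_, neg_neg z⟩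
    by_contra h'
    rw [Complex.mem_slitPlane_iff, not_or, not_lt, not_ne_iff, Complex.neg_re, Complex.neg_im] at h'
    refine h ⟨z.re, ?_, ?_⟩
    · rw [Set.mem_Ici]; linarith [h'.1]
    · apply Complex.ext <;> simp; linarith [h'.2]
  · rintro ⟨w, hw, rfl⟩ ⟨x, hx, h⟩
    rw [Set.mem_Ici] at hx
    have hw' : w = ((-x : ℝ) : ℂ) := by
      rw [Complex.ofReal_neg]
      exact eq_neg_iff_add_eq_zero.mpr (by simpa using congrArg (w + ·) h)
    rw [hw', Complex.mem_slitPlane_iff, Complex.ofReal_re, Complex.ofReal_im] at hw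
    rcases hw with hw | hw
    · linarith
    · exact hw rfl

theorem isPreconnected_cutPlane : IsPreconnected cutPlane := by
  rw [cutPlane_eq_neg_image]
  exact (Complex.starConvex_one_slitPlane.isPathConnected
    Complex.one_mem_slitPlane).isConnected.isPreconnected.image _ continuous_neg.continuousOn

theorem neg_ofReal_mem_cutPlane {t : ℝ} (ht : 0 < t) : -(t : ℂ) ∈ cutPlane := by
  rintro ⟨x, hx, h⟩
  rw [Set.mem_Ici] at hx
  have : x = -t := by simpa using congrArg Complex.re h
  linarith

/-- The bound is uniform in `w` near `z` as well as in `x`, as domination under the integral sign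
requires. -/
theorem exists_forall_le_norm_sub {z : ℂ} (hz : z ∈ cutPlane) :
    ∃ ε > 0, ∀ w ∈ Metric.ball z ε, ∀ x : ℝ≥0, ε ≤ ‖((x : ℝ) : ℂ) - w‖ := by
  obtain ⟨ε, hε, h⟩ := Metric.isOpen_iff.mp isOpen_cutPlane z hz
  refine ⟨ε / 2, by positivity, fun w hw x => ?_⟩
  have h1 : ε ≤ ‖((x : ℝ) : ℂ) - z‖ := by
    by_contra! h2
    exact h (by rwa [Metric.mem_ball, dist_eq_norm]) ⟨x, x.2, rfl⟩
  have h2 : ‖w - z‖ < ε / 2 := by rwa [Metric.mem_ball, dist_eq_norm] at hw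
  have h3 : ‖((x : ℝ) : ℂ) - z‖ ≤ ‖((x : ℝ) : ℂ) - w‖ + ‖w - z‖ := by
    simpa using norm_add_le (((x : ℝ) : ℂ) - w) (w - z)
  linarith

/-- Two holomorphic functions on `ℂ - ℝ⁺` which agree near `-∞` are equal. -/
theorem eqOn_cutPlane {f g : ℂ → ℂ} (hf : DifferentiableOn ℂ f cutPlane)
    (hg : DifferentiableOn ℂ g cutPlane)
    (h : ∀ᶠ t : ℝ in atTop, f (-(t : ℂ)) = g (-(t : ℂ))) : Set.EqOn f g cutPlane := by
  obtain ⟨a, ha⟩ := eventually_atTop.mp h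
  set b := max a 1 with hb
  have hb0 : 0 < b := lt_of_lt_of_le one_pos (le_max_right _ _)
  refine (hf.analyticOnNhd isOpen_cutPlane).eqOn_of_preconnected_of_frequently_eq
    (hg.analyticOnNhd isOpen_cutPlane) isPreconnected_cutPlane (z₀ := -(b : ℂ))
    (neg_ofReal_mem_cutPlane hb0) ?_
  -- The points `-t` with `t` decreasing to `b` accumulate at `-b` without meeting it.
  have ht : Tendsto (fun t : ℝ => -(t : ℂ)) (𝓝[>] b) (𝓝[≠] (-(b : ℂ))) := by
    refine tendsto_nhdsWithin_of_tendsto_nhds_of_eventually_within _ ?_ ?_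
    · exact ((Complex.continuous_ofReal.neg).tendsto b).mono_left nhdsWithin_le_nhds
    · filter_upwards [self_mem_nhdsWithin] with t (ht : b < t) h
      have : t = b := by simpa using h
      linarith
  refine ht.frequently (Eventually.frequently ?_)
  filter_upwards [self_mem_nhdsWithin] with t (ht : b < t)
  exact ha t ((le_max_left _ _).trans ht.le)

end CutPlane

/-! ### Holomorphy of Stieltjes integrals -/

section Stieltjes

variable {Ω : Type*} [MeasurableSpace Ω]

theorem norm_one_div_sub_le {z : ℂ} {ε : ℝ} (hε : 0 < ε)
    (h : ∀ x : ℝ≥0, ε ≤ ‖((x : ℝ) : ℂ) - z‖) (x : ℝ≥0) :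
    ‖1 / (((x : ℝ) : ℂ) - z)‖ ≤ ε⁻¹ := by
  rw [norm_div, norm_one, one_div]
  exact inv_anti₀ hε (h x)

theorem exists_norm_one_div_sub_le {z : ℂ} (hz : z ∈ cutPlane) :
    ∃ C : ℝ, ∀ x : ℝ≥0, ‖1 / (((x : ℝ) : ℂ) - z)‖ ≤ C := by
  obtain ⟨ε, hε, h⟩ := exists_forall_le_norm_sub hz
  exact ⟨_, norm_one_div_sub_le hε (h z (Metric.mem_ball_self hε))⟩

theorem continuous_one_div_sub {z : ℂ} (hz : z ∈ cutPlane) :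
    Continuous fun x : ℝ≥0 => 1 / (((x : ℝ) : ℂ) - z) :=
  continuous_const.div₀ (by fun_prop) fun x => sub_ne_zero_of_mem_cutPlane hz x.2

theorem measurable_one_div_sub (z : ℂ) :
    Measurable fun x : ℝ≥0 => 1 / (((x : ℝ) : ℂ) - z) :=
  measurable_const.div ((Complex.measurable_ofReal.comp measurable_subtype_coe).sub_const z)

theorem integrable_mul_one_div_sub {ν : Measure Ω} {x : Ω → ℝ≥0} (hx : Measurable x)
    {g : Ω → ℂ} (hg : Integrable g ν) {z : ℂ} (hz : z ∈ cutPlane) :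
    Integrable (fun p => g p * (1 / (((x p : ℝ) : ℂ) - z))) ν := by
  obtain ⟨C, hC⟩ := exists_norm_one_div_sub_le hz
  exact hg.mul_bdd (c := C) ((measurable_one_div_sub z).comp hx).aestronglyMeasurable
    (ae_of_all _ fun p => hC _)

/-- The general `x` and `g` cover both uses: `x = id`, `g = 1` for scalar Stieltjes transforms, and
a projection with a density for the entries of matrix transforms. -/
theorem differentiableOn_integral_one_div_sub {ν : Measure Ω} {x : Ω → ℝ≥0} (hx : Measurable x)
    {g : Ω → ℂ} (hg : Integrable g ν) :
    DifferentiableOn ℂ (fun z => ∫ p, g p * (1 / (((x p : ℝ) : ℂ) - z)) ∂ν) cutPlane := by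
  intro z hz
  obtain ⟨ε, hε, h⟩ := exists_forall_le_norm_sub hz
  refine DifferentiableAt.differentiableWithinAt ?_
  refine (hasDerivAt_integral_of_dominated_loc_of_deriv_le (𝕜 := ℂ) (μ := ν)
    (F := fun z p => g p * (1 / (((x p : ℝ) : ℂ) - z)))
    (F' := fun z p => g p * (1 / (((x p : ℝ) : ℂ) - z)) ^ 2)
    (bound := fun p => ‖g p‖ * ε⁻¹ ^ 2)
    (Metric.ball_mem_nhds z hε) (Eventually.of_forall fun w => ?_)
    (integrable_mul_one_div_sub hx hg hz) ?_ (ae_of_all _ fun p w hw => ?_)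
    (hg.norm.mul_const _) (ae_of_all _ fun p w hw => ?_)).2.differentiableAt
  · exact hg.aestronglyMeasurable.mul ((measurable_one_div_sub w).comp hx).aestronglyMeasurable
  · exact hg.aestronglyMeasurable.mul
      (((measurable_one_div_sub z).comp hx).pow_const 2).aestronglyMeasurable
  · rw [norm_mul, norm_pow]
    gcongr
    exact norm_one_div_sub_le hε (h w hw) _
  · have hne : ((x p : ℝ) : ℂ) - w ≠ 0 := fun h0 => by
      have := h w hw (x p)
      rw [h0, norm_zero] at this
      linarith
    have h1 : HasDerivAt (fun w => ((x p : ℝ) : ℂ) - w) (-1) w := by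
      simpa using (hasDerivAt_id w).const_sub ((x p : ℝ) : ℂ)
    have h2 := (h1.fun_inv hne).const_mul (g p)
    simp only [one_div]
    rwa [neg_neg, one_div, ← inv_pow] at h2

end Stieltjes

/-! ### Scalar Stieltjes transforms on the negative axis -/

section StieltjesClass

theorem exists_differentiableOn_of_mem_stieltjesClass {f : cutPlane → ℂ} (hf : f ∈ StieltjesClass) :
    ∃ F : ℂ → ℂ, DifferentiableOn ℂ F cutPlane ∧ ∀ z : cutPlane, f z = F z := by
  obtain ⟨μ, hμ, h⟩ := hf
  refine ⟨_, differentiableOn_integral_one_div_sub (ν := μ) (x := id) measurable_id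
    (g := fun _ => 1) (integrable_const _), fun z => ?_⟩
  rw [h]; simp

/-- At `-t` the integrand `1 / (x + t)` is real and lies in `(0, 1 / t]`, and the measure has mass
1. -/
theorem ne_zero_and_norm_le_of_mem_stieltjesClass {f : cutPlane → ℂ} (hf : f ∈ StieltjesClass)
    {t : ℝ} (ht : 0 < t) :
    f ⟨-(t : ℂ), neg_ofReal_mem_cutPlane ht⟩ ≠ 0 ∧
      ‖f ⟨-(t : ℂ), neg_ofReal_mem_cutPlane ht⟩‖ ≤ 1 / t := by
  obtain ⟨μ, hμ, h⟩ := hf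
  have h1 : ∀ x : ℝ≥0, 1 / (((x : ℝ) : ℂ) - -(t : ℂ)) = ((1 / ((x : ℝ) + t) : ℝ) : ℂ) := by
    intro x; push_cast; rw [sub_neg_eq_add]
  have hb : ∀ x : ℝ≥0, ‖1 / ((x : ℝ) + t)‖ ≤ 1 / t := fun x => by
    rw [Real.norm_of_nonneg (by positivity)]
    gcongr
    linarith [x.2]
  have hint : Integrable (fun x : ℝ≥0 => 1 / ((x : ℝ) + t)) μ :=
    Integrable.of_bound (Measurable.aestronglyMeasurable (by fun_prop)) _ (ae_of_all _ hb)
  rw [h]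
  simp only [h1]
  rw [integral_complex_ofReal]
  constructor
  · rw [Complex.ofReal_ne_zero]
    refine ne_of_gt ((integral_pos_iff_support_of_nonneg (fun x => by positivity) hint).mpr ?_)
    have : Function.support (fun x : ℝ≥0 => 1 / ((x : ℝ) + t)) = Set.univ := by
      ext x
      simp only [Function.mem_support, Set.mem_univ, iff_true]
      positivity
    rw [this, measure_univ]; exact one_pos
  · rw [Complex.norm_real]
    simpa using norm_integral_le_of_norm_le_const (μ := μ) (ae_of_all _ hb)

end StieltjesClass

/-! ### Integration against a complex measure with density -/

section DensityIntegral

variable {X : Type*} [MeasurableSpace X]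

/-- The integral of a bounded function against the complex measure `g dν`. -/
theorem integral_withDensityᵥ_eq {ν : Measure X} {g : X → ℂ} (hg : Integrable g ν) {f : X → ℂ}
    (hf : StronglyMeasurable f) {C : ℝ} (hC : ∀ x, ‖f x‖ ≤ C) :
    (ν.withDensityᵥ g).Integrable f ∧
    (ν.withDensityᵥ g).integral f (ContinuousLinearMap.mul ℝ ℂ) = ∫ x, g x * f x ∂ν := by
  have hfin : IsFiniteMeasure (ν.withDensityᵥ g).variation := by
    rw [Measure.variation_withDensityᵥ hg]
    exact ⟨by simpa using! hg.2⟩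
  have hint : ∀ {f : X → ℂ}, StronglyMeasurable f → ∀ {C : ℝ}, (∀ x, ‖f x‖ ≤ C) →
      (ν.withDensityᵥ g).Integrable f := fun hf C hC =>
    Integrable.of_bound hf.aestronglyMeasurable C (ae_of_all _ hC)
  refine ⟨hint hf hC, ?_⟩
  -- Agreement on indicators gives simple functions; dominated convergence on each side then reaches
  -- bounded `f`.
  have hsimple : ∀ s : SimpleFunc X ℂ,
      (ν.withDensityᵥ g).integral s (ContinuousLinearMap.mul ℝ ℂ) = ∫ x, g x * s x ∂ν := by
    intro s
    have hsint : ∀ s : SimpleFunc X ℂ, (ν.withDensityᵥ g).Integrable s := fun s => by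
      obtain ⟨C, hC⟩ := s.exists_forall_norm_le
      exact hint s.stronglyMeasurable hC
    have hsint' : ∀ s : SimpleFunc X ℂ, Integrable (fun x => g x * s x) ν := fun s => by
      obtain ⟨C, hC⟩ := s.exists_forall_norm_le
      exact hg.mul_bdd (c := C) s.stronglyMeasurable.aestronglyMeasurable (ae_of_all _ hC)
    induction s using SimpleFunc.induction with
    | const c hs =>
      rename_i s
      have e : ⇑(SimpleFunc.piecewise s hs (SimpleFunc.const X c) (SimpleFunc.const X 0)) =
          s.indicator fun _ => c := by
        ext x; simp [Set.indicator, Set.piecewise]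
      have e2 : (fun x => g x * s.indicator (fun _ => c) x) = s.indicator fun x => g x * c := by
        ext x; by_cases hx : x ∈ s <;> simp [hx]
      rw [e, VectorMeasure.integral_indicator hs, VectorMeasure.setIntegral_const,
        withDensityᵥ_apply hg hs]
      rw [e2, integral_indicator hs, integral_mul_const, ContinuousLinearMap.mul_apply', mul_comm]
    | add hd h1 h2 =>
      rename_i f1 f2
      rw [SimpleFunc.coe_add, VectorMeasure.integral_add (hsint f1) (hsint f2), h1, h2,
        ← integral_add (hsint' f1) (hsint' f2)]
      refine integral_congr_ae (ae_of_all _ fun x => ?_)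
      simp [mul_add]
  have hbd : ∀ n x, ‖hf.approxBounded C n x‖ ≤ C := fun n x => by
    refine hf.norm_approxBounded_le ?_ n x
    exact (norm_nonneg _).trans (hC x)
  have hlim : ∀ x, Tendsto (fun n => hf.approxBounded C n x) atTop (𝓝 (f x)) := fun x =>
    hf.tendsto_approxBounded_of_norm_le (hC x)
  have h1 : Tendsto (fun n => (ν.withDensityᵥ g).integral (hf.approxBounded C n)
      (ContinuousLinearMap.mul ℝ ℂ)) atTop
      (𝓝 ((ν.withDensityᵥ g).integral f (ContinuousLinearMap.mul ℝ ℂ))) :=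
    VectorMeasure.tendsto_integral_of_dominated_convergence (fun _ => C)
    (fun n => (hf.approxBounded C n).stronglyMeasurable.aestronglyMeasurable)
    (integrable_const _) (fun n => ae_of_all _ (hbd n)) (ae_of_all _ hlim)
  have h2 := tendsto_integral_of_dominated_convergence (μ := ν)
    (F := fun n x => g x * hf.approxBounded C n x) (f := fun x => g x * f x)
    (fun x => ‖g x‖ * C)
    (fun n => hg.aestronglyMeasurable.mul
      (hf.approxBounded C n).stronglyMeasurable.aestronglyMeasurable)
    (hg.norm.mul_const _)
    (fun n => ae_of_all _ fun x => by rw [norm_mul]; gcongr; exact hbd n x)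
    (ae_of_all _ fun x => (hlim x).const_mul _)
  simp only [hsimple] at h1
  exact tendsto_nhds_unique h1 h2

end DensityIntegral

/-! ### Compactness and existence of a fixed point -/

section Represents

variable {ι : Type} [Fintype ι] [DecidableEq ι]

variable (ι) in
/-- Pairs of a spectral value and a bounded vector. A measure `ν` on this space encodes the positive
matrix-valued measure `s ↦ ∫_{x ∈ s} v vᴴ dν(x, v)`. -/
abbrev VectorSpectrum : Type :=
  ℝ≥0 × Metric.closedBall (0 : ι → ℂ) (Real.sqrt (Fintype.card ι))

/-- The entry `(i, j)` of `v vᴴ`. -/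
def outer (i j : ι) (p : VectorSpectrum ι) : ℂ := p.2.1 i * star (p.2.1 j)

omit [DecidableEq ι] in
theorem continuous_outer (i j : ι) : Continuous (outer i j) := by
  have h : ∀ i, Continuous fun p : VectorSpectrum ι => p.2.1 i := fun i =>
    (continuous_apply i).comp (continuous_subtype_val.comp continuous_snd)
  exact (h i).mul (h j).star

omit [DecidableEq ι] in
theorem norm_outer_le (i j : ι) (p : VectorSpectrum ι) : ‖outer i j p‖ ≤ Fintype.card ι := by
  have h : ∀ i, ‖p.2.1 i‖ ≤ Real.sqrt (Fintype.card ι) := fun i =>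
    (norm_le_pi_norm _ i).trans (mem_closedBall_zero_iff.mp p.2.2)
  rw [outer, norm_mul, norm_star]
  calc _ ≤ Real.sqrt (Fintype.card ι) * Real.sqrt (Fintype.card ι) := by
        gcongr <;> exact h _
    _ = _ := Real.mul_self_sqrt (by positivity)

omit [DecidableEq ι] in
theorem integrable_outer (ν : Measure (VectorSpectrum ι)) [IsFiniteMeasure ν] (i j : ι) :
    Integrable (outer i j) ν :=
  Integrable.of_bound (continuous_outer i j).measurable.aestronglyMeasurable _
    (ae_of_all _ (norm_outer_le i j))

/-- `F` is the Stieltjes transform of the matrix-valued measure encoded by `ν`, which has total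
mass `1`. -/
structure Represents (ν : Measure (VectorSpectrum ι)) (F : ℂ → Matrix ι ι ℂ) : Prop where
  mass : ∀ i j, ∫ p, outer i j p ∂ν = (1 : Matrix ι ι ℂ) i j
  transform : ∀ z ∈ cutPlane, ∀ i j,
    F z i j = ∫ p, outer i j p * (1 / (((p.1 : ℝ) : ℂ) - z)) ∂ν

/-- The probability measures on `VectorSpectrum ι` with a Markov type tail bound. -/
def tailBounded (ι : Type) [Fintype ι] (C : ℝ≥0) : Set (ProbabilityMeasure (VectorSpectrum ι)) :=
  {ν | ∀ n : ℕ, ν (Set.Iic ((n : ℝ≥0) + 1) ×ˢ Set.univ)ᶜ ≤ C / (n + 1)}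

omit [DecidableEq ι] in
-- Prokhorov's criterion: all but mass `C / (n + 1)` lies in `[0, n + 1]` times a closed ball of a
-- finite-dimensional space, which is compact.
theorem isCompact_tailBounded (C : ℝ≥0) : IsCompact (tailBounded ι C) := by
  refine isCompact_setOfPred_probabilityMeasure_mass_eq_compl_isCompact_le ?_ (fun n => ?_)
    (Or.inl inferInstance)
  · rw [← NNReal.tendsto_coe]
    push_cast
    exact tendsto_const_div_atTop_nhds_zero_nat (C : ℝ) |>.comp (tendsto_add_atTop_nat 1) |>.congr
      fun n => by simp
  · refine IsCompact.prod ?_ isCompact_univ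
    have : Set.Iic ((n : ℝ≥0) + 1) = Set.Icc 0 ((n : ℝ≥0) + 1) := by ext; simp
    rw [this]; exact isCompact_Icc

/-- Each `u uᴴ`, for `u` a column of `U`, is split as `w v vᴴ` with `w = |u|² / d`, where `d = card
ι`. The weights sum to `tr (U Uᴴ) / d = 1`, giving a scalar probability measure, and `v` has
Euclidean length `√d` or is 0, hence lies in the ball. The tail bound is Markov's inequality for the
first moment. -/
theorem IsAtomic.exists_represents [Nonempty ι] {C : ℝ} {F : ℂ → Matrix ι ι ℂ}
    (hF : IsAtomic C F) : ∃ ν ∈ tailBounded ι C.toNNReal, Represents (ν : Measure _) F := by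
  obtain ⟨κ, _, _, U, m, hm, hU, hC, hFU⟩ := hF
  have hd : (1 : ℝ) ≤ Fintype.card ι := by exact_mod_cast Fintype.card_pos
  have hd0 : (0 : ℝ) < Fintype.card ι := by linarith
  set w : κ → ℝ := fun k => (∑ i, ‖U i k‖ ^ 2) / Fintype.card ι with hw
  have hw0 : ∀ k, 0 ≤ w k := fun k => by positivity
  have hUw : ∀ i k, ‖U i k‖ ≤ Real.sqrt (Fintype.card ι) * Real.sqrt (w k) := fun i k => by
    rw [← Real.sqrt_mul hd0.le]
    apply Real.le_sqrt_of_sq_le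
    rw [hw, mul_div_cancel₀ _ hd0.ne']
    exact Finset.single_le_sum (f := fun i => ‖U i k‖ ^ 2) (fun _ _ => by positivity)
      (Finset.mem_univ i)
  -- If `w k = 0` the quotient is 0 by convention; this is harmless because the column then
  -- vanishes.
  set v : κ → Metric.closedBall (0 : ι → ℂ) (Real.sqrt (Fintype.card ι)) := fun k =>
    ⟨fun i => U i k / (Real.sqrt (w k) : ℂ), by
      rw [mem_closedBall_zero_iff, pi_norm_le_iff_of_nonneg (by positivity)]
      intro i
      rw [norm_div, Complex.norm_real, Real.norm_of_nonneg (Real.sqrt_nonneg _)]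
      exact div_le_of_le_mul₀ (Real.sqrt_nonneg _) (Real.sqrt_nonneg _) (hUw i k)⟩ with hv
  have hwv : ∀ k i j, (w k : ℂ) * ((v k).1 i * star ((v k).1 j)) = U i k * star (U j k) := by
    intro k i j
    rcases (hw0 k).eq_or_lt with h0 | h0
    · have : U i k = 0 := by
        have := hUw i k
        rw [← h0, Real.sqrt_zero, mul_zero] at this
        exact norm_le_zero_iff.mp this
      rw [← h0, this]; simp
    · have hs : (Real.sqrt (w k) : ℂ) ≠ 0 := by
        rw [Complex.ofReal_ne_zero]; exact (Real.sqrt_pos.mpr h0).ne'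
      have hs2 : (w k : ℂ) = (Real.sqrt (w k) : ℂ) * (Real.sqrt (w k) : ℂ) := by
        rw [← Complex.ofReal_mul, Real.mul_self_sqrt h0.le]
      simp only [hv, star_div₀, Complex.star_def, Complex.conj_ofReal]
      rw [hs2]; field_simp
  have hmass : ∑ k, w k = 1 := by
    have h1 := trace_mul_diagonal_mul_conjTranspose U 1
    have e1 : (diagonal fun k => (((1 : κ → ℝ) k : ℝ) : ℂ)) = 1 := by
      simp
    rw [e1, Matrix.mul_one, hU, trace_one] at h1
    have h2 : (Fintype.card ι : ℝ) = ∑ k, ∑ i, ‖U i k‖ ^ 2 := by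
      have : ((Fintype.card ι : ℝ) : ℂ) = ((∑ k, ∑ i, ‖U i k‖ ^ 2 : ℝ) : ℂ) := by
        simpa using h1
      exact_mod_cast this
    rw [hw, ← Finset.sum_div, ← h2, div_self hd0.ne']
  set q : κ → VectorSpectrum ι := fun k => ((m k).toNNReal, v k) with hq
  set μ : Measure (VectorSpectrum ι) :=
    ∑ k, ENNReal.ofReal (w k) • Measure.dirac (q k) with hμ
  have hμp : IsProbabilityMeasure μ := ⟨by
    rw [hμ]
    simp only [Measure.coe_finsetSum, Finset.sum_apply, Measure.smul_apply, smul_eq_mul,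
      measure_univ, mul_one]
    rw [← ENNReal.ofReal_sum_of_nonneg fun k _ => hw0 k, hmass, ENNReal.ofReal_one]⟩
  have hint : ∀ f : VectorSpectrum ι → ℂ,
      ∫ p, f p ∂μ = ∑ k, (w k : ℂ) * f (q k) := by
    intro f
    rw [hμ, integral_finsetSum_measure fun k _ =>
      (integrable_dirac (a := q k) (f := f) enorm_lt_top).smul_measure ENNReal.ofReal_ne_top]
    refine Finset.sum_congr rfl fun k _ => ?_
    rw [integral_smul_measure, integral_dirac, ENNReal.toReal_ofReal (hw0 k), Complex.real_smul]
  set P : ProbabilityMeasure (VectorSpectrum ι) := ⟨μ, hμp⟩ with hP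
  have hPμ : (P : Measure (VectorSpectrum ι)) = μ := rfl
  refine ⟨P, fun n => ?_, ⟨fun i j => ?_, fun z hz i j => ?_⟩⟩
  · have key : μ (Set.Iic ((n : ℝ≥0) + 1) ×ˢ Set.univ)ᶜ ≤ ENNReal.ofReal (C / (n + 1)) := by
      rw [hμ]
      simp only [Measure.coe_finsetSum, Finset.sum_apply, Measure.smul_apply, smul_eq_mul]
      have hn : (0 : ℝ) < n + 1 := by positivity
      calc _ ≤ ∑ k, ENNReal.ofReal (w k * m k / (n + 1)) := by
            refine Finset.sum_le_sum fun k _ => ?_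
            rw [Measure.dirac_apply]
            by_cases hk : m k ≤ n + 1
            · rw [Set.indicator_of_notMem]
              · simp
              · rw [Set.mem_compl_iff, not_not]
                exact ⟨Real.toNNReal_le_iff_le_coe.mpr (by simpa using hk), trivial⟩
            · refine (mul_le_mul_right (Set.indicator_le_self' (by simp) _) _).trans ?_
              rw [Pi.one_apply, mul_one]
              apply ENNReal.ofReal_le_ofReal
              rw [le_div_iff₀ hn]
              exact mul_le_mul_of_nonneg_left (not_le.mp hk).le (hw0 k)
        _ = ENNReal.ofReal (∑ k, w k * m k / (n + 1)) :=
            (ENNReal.ofReal_sum_of_nonneg fun k _ => by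
              have := hw0 k; have := hm k; positivity).symm
        _ ≤ _ := by
            apply ENNReal.ofReal_le_ofReal
            rw [← Finset.sum_div]
            gcongr
            calc ∑ k, w k * m k = (∑ k, m k * ∑ i, ‖U i k‖ ^ 2) / Fintype.card ι := by
                  rw [Finset.sum_div]
                  refine Finset.sum_congr rfl fun k _ => ?_
                  rw [hw]; ring
              _ ≤ ∑ k, m k * ∑ i, ‖U i k‖ ^ 2 :=
                  div_le_self (Finset.sum_nonneg fun k _ =>
                    mul_nonneg (hm k) (Finset.sum_nonneg fun _ _ => by positivity)) hd
              _ ≤ C := hC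
    have e : ENNReal.ofReal (C / (n + 1)) = ((C.toNNReal / (n + 1) : ℝ≥0) : ENNReal) := by
      rw [ENNReal.ofReal]
      congr 1
      rw [Real.toNNReal_div' (by positivity)]
      congr 1
      ext; rw [Real.coe_toNNReal _ (by positivity)]; simp
    rw [e] at key
    rw [← ENNReal.coe_le_coe, ProbabilityMeasure.ennreal_coeFn_eq_coeFn_toMeasure, hPμ]
    exact key
  · rw [hPμ, hint, ← hU, Matrix.mul_apply]
    refine Finset.sum_congr rfl fun k _ => ?_
    rw [outer, hwv, conjTranspose_apply]
  · rw [hPμ, hint, hFU z hz, atomicTransform,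
      mul_diagonal_mul_conjTranspose_apply]
    refine Finset.sum_congr rfl fun k _ => ?_
    rw [← mul_assoc, outer, hwv, one_div, Real.coe_toNNReal _ (hm k)]
    ring

/-- A weak limit of atomic transforms with bounded first moment. -/
theorem exists_ultrafilter_limit [Nonempty ι] {C : ℝ} {F : ℕ → ℂ → Matrix ι ι ℂ}
    (hF : ∀ m, IsAtomic C (F m)) :
    ∃ (𝓤 : Ultrafilter ℕ) (ν : ProbabilityMeasure (VectorSpectrum ι)) (X : ℂ → Matrix ι ι ℂ),
      (𝓤 : Filter ℕ) ≤ atTop ∧ Represents (ν : Measure _) X ∧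
      ∀ z ∈ cutPlane, ∀ i j, Tendsto (fun m => F m z i j) 𝓤 (𝓝 (X z i j)) := by
  choose μ hμ hrep using fun m => (hF m).exists_represents
  have hle : (hyperfilter ℕ : Filter ℕ) ≤ atTop := by
    rw [← Nat.cofinite_eq_atTop]; exact hyperfilter_le_cofinite
  obtain ⟨ν, -, hν⟩ := (isCompact_tailBounded (ι := ι) C.toNNReal).ultrafilter_le_nhds
    ((hyperfilter ℕ).map μ) (by
      rw [le_principal_iff]
      exact Eventually.of_forall (f := (hyperfilter ℕ : Filter ℕ)) hμ)
  have hlim : Tendsto μ (hyperfilter ℕ) (𝓝 ν) := hν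
  rw [ProbabilityMeasure.tendsto_iff_forall_integral_rclike_tendsto ℂ] at hlim
  -- Because the vectors are bounded, the entries of `v vᴴ`, alone or times the kernel, are
  -- admissible test functions; so both mass and transform pass to the weak limit.
  have hlim' : ∀ f : VectorSpectrum ι → ℂ, Continuous f → ∀ c : ℝ, (∀ p, ‖f p‖ ≤ c) →
      Tendsto (fun m => ∫ p, f p ∂(μ m : Measure _)) (hyperfilter ℕ)
        (𝓝 (∫ p, f p ∂(ν : Measure _))) := fun f hf c hc =>
    hlim (BoundedContinuousFunction.ofNormedAddCommGroup f hf c hc)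
  refine ⟨hyperfilter ℕ, ν,
    fun z => Matrix.of fun i j => ∫ p, outer i j p * (1 / (((p.1 : ℝ) : ℂ) - z)) ∂(ν : Measure _),
    hle, ⟨fun i j => ?_, fun z hz i j => rfl⟩, fun z hz i j => ?_⟩
  · have h1 := hlim' (outer i j) (continuous_outer i j) _ (norm_outer_le i j)
    simp only [(hrep _).mass] at h1
    exact tendsto_nhds_unique h1 tendsto_const_nhds
  · obtain ⟨c, hc⟩ := exists_norm_one_div_sub_le hz
    have h1 := hlim' (fun p => outer i j p * (1 / (((p.1 : ℝ) : ℂ) - z)))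
      ((continuous_outer i j).mul ((continuous_one_div_sub hz).comp continuous_fst))
      (Fintype.card ι * c) (fun p => by
        rw [norm_mul]
        exact mul_le_mul (norm_outer_le i j p) (hc _) (norm_nonneg _) (by positivity))
    refine h1.congr fun m => ?_
    exact ((hrep m).transform z hz i j).symm

theorem Represents.differentiableOn {ν : Measure (VectorSpectrum ι)} [IsFiniteMeasure ν]
    {X : ℂ → Matrix ι ι ℂ} (h : Represents ν X) (i j : ι) :
    DifferentiableOn ℂ (fun z => X z i j) cutPlane :=
  (differentiableOn_integral_one_div_sub (ν := ν) (x := Prod.fst) measurable_fst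
    (integrable_outer ν i j)).congr fun z hz => h.transform z hz i j

/-- Existence of a solution of `X(z) (-z (1 + η (diag X(z)))) = 1`. -/
theorem exists_represents_fixedPoint [Nonempty ι] {η : (ι → ℂ) →ₗ[ℂ] Matrix ι ι ℂ}
    (hη : IsPositiveMap η) :
    ∃ (ν : ProbabilityMeasure (VectorSpectrum ι)) (X : ℂ → Matrix ι ι ℂ),
      Represents (ν : Measure _) X ∧
      ∀ z ∈ cutPlane, X z * ((-z) • (1 + η (X z).diag)) = 1 := by
  obtain ⟨F, hF0, hFa, hFs⟩ := exists_atomic_iteration hη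
  -- The limit is taken over `F (m + 1)`, since only these come with the common moment bound.
  obtain ⟨𝓤, ν, X, hle, hrep, hlim⟩ := exists_ultrafilter_limit hFa
  refine ⟨ν, X, hrep, fun z hz => ?_⟩
  -- Each entry of the equation is a polynomial in matrix entries, so limits and holomorphy can be
  -- checked entrywise.
  have entry : ∀ (Y Y' : Matrix ι ι ℂ) (z : ℂ) (i j : ι),
      (Y' * ((-z) • (1 + η Y.diag))) i j = ∑ k, Y' i k *
        (-z * ((1 : Matrix ι ι ℂ) k j + ∑ s, Y s s * η (Pi.single s 1) k j)) := by
    intro Y Y' z i j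
    rw [map_eq_sum_single, Matrix.mul_apply]
    simp [Matrix.sum_apply]
  obtain ⟨t₀, ht₀, hconv⟩ := exists_tendsto_iterate_sub η
  have hreal : ∀ t : ℝ, t₀ < t → X (-(t : ℂ)) * ((- -(t : ℂ)) • (1 + η (X (-(t : ℂ))).diag)) = 1 := by
    intro t ht
    have htm := neg_ofReal_mem_cutPlane (ht₀.trans ht)
    have hdiff := hconv t ht (fun m => F m (-(t : ℂ))) (by simp [hF0])
      (fun m => by simpa using hFs m _ htm)
    have h1 : ∀ i j, Tendsto (fun m => F (m + 1) (-(t : ℂ)) i j) 𝓤 (𝓝 (X (-(t : ℂ)) i j)) :=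
      hlim _ htm
    -- An ultrafilter is not shift invariant; the vanishing increments are what give consecutive
    -- iterates the same limit.
    have h2 : ∀ i j, Tendsto (fun m => F (m + 2) (-(t : ℂ)) i j) 𝓤 (𝓝 (X (-(t : ℂ)) i j)) := by
      intro i j
      have hd : Tendsto (fun m => (F (m + 1) (-(t : ℂ)) - F m (-(t : ℂ))) i j) atTop (𝓝 0) :=
        ((continuous_apply_apply i j).tendsto (0 : Matrix ι ι ℂ)).comp hdiff
      have hd' : Tendsto (fun m => (F (m + 2) (-(t : ℂ)) - F (m + 1) (-(t : ℂ))) i j) 𝓤 (𝓝 0) :=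
        (hd.comp (tendsto_add_atTop_nat 1)).mono_left hle
      have := (h1 i j).add hd'
      rw [add_zero] at this
      exact this.congr fun m => by simp
    ext i j
    rw [entry]
    have h3 : Tendsto (fun m => (F (m + 2) (-(t : ℂ)) *
        ((- -(t : ℂ)) • (1 + η (F (m + 1) (-(t : ℂ))).diag))) i j) 𝓤
        (𝓝 (∑ k, X (-(t : ℂ)) i k * (- -(t : ℂ) * ((1 : Matrix ι ι ℂ) k j +
          ∑ s, X (-(t : ℂ)) s s * η (Pi.single s 1) k j)))) := by
      simp only [entry]
      exact tendsto_finsetSum _ fun k _ => (h2 i k).mul (tendsto_const_nhds.mul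
        (tendsto_const_nhds.add (tendsto_finsetSum _ fun s _ => (h1 s s).mul_const _)))
    refine tendsto_nhds_unique h3 (tendsto_const_nhds.congr fun m => ?_)
    rw [hFs (m + 1) _ htm]
  ext i j
  rw [entry]
  have hX : ∀ i j, DifferentiableOn ℂ (fun z => X z i j) cutPlane := hrep.differentiableOn
  have hdiff : DifferentiableOn ℂ (fun z => ∑ k, X z i k *
      (-z * ((1 : Matrix ι ι ℂ) k j + ∑ s, X z s s * η (Pi.single s 1) k j))) cutPlane := by
    refine DifferentiableOn.fun_sum fun k _ => (hX i k).mul (differentiableOn_id.neg.mul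
      ((differentiableOn_const _).add ?_))
    exact DifferentiableOn.fun_sum fun s _ => (hX s s).mul_const _
  refine eqOn_cutPlane hdiff (differentiableOn_const ((1 : Matrix ι ι ℂ) i j)) ?_ hz
  filter_upwards [eventually_gt_atTop t₀] with t ht
  exact (entry _ _ _ i j).symm.trans (congrFun (congrFun (hreal t ht) i) j)

end Represents

/-! ### Matrix and scalar measures extracted from the representation -/

section Representation

variable {ι : Type} [Fintype ι] [DecidableEq ι]
  {ν : Measure (VectorSpectrum ι)} [IsFiniteMeasure ν] {X : ℂ → Matrix ι ι ℂ}

omit [DecidableEq ι] in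
-- The quadratic form at `x` is the integral of `|⟨x, v⟩|²`, with `v` restricted along `e`.
theorem posSemidef_setIntegral_outer {k : ℕ} (e : Fin k → ι) (s : Set (VectorSpectrum ι)) :
    (Matrix.of fun i j => ∫ p in s, outer (e i) (e j) p ∂ν).PosSemidef := by
  refine PosSemidef.of_dotProduct_mulVec_nonneg ?_ fun x => ?_
  · ext i j
    rw [conjTranspose_apply, of_apply, of_apply, Complex.star_def, ← integral_conj]
    refine integral_congr_ae (ae_of_all _ fun p => ?_)
    simp [outer, mul_comm]
  · have h1 : star x ⬝ᵥ (Matrix.of fun i j => ∫ p in s, outer (e i) (e j) p ∂ν) *ᵥ x =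
        ∫ p in s, ((‖∑ i, star (x i) * p.2.1 (e i)‖ ^ 2 : ℝ) : ℂ) ∂ν := by
      have h2 : ∀ p : VectorSpectrum ι, ((‖∑ i, star (x i) * p.2.1 (e i)‖ ^ 2 : ℝ) : ℂ) =
          ∑ i, ∑ j, (star (x i) * x j) * outer (e i) (e j) p := by
        intro p
        rw [Complex.ofReal_pow, ← Complex.mul_conj', map_sum, Finset.sum_mul_sum]
        refine Finset.sum_congr rfl fun i _ => Finset.sum_congr rfl fun j _ => ?_
        simp only [outer, map_mul, Complex.star_def, Complex.conj_conj]
        ring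
      simp only [h2]
      have hi : ∀ i j, Integrable (fun p => (star (x i) * x j) * outer (e i) (e j) p)
          (ν.restrict s) := fun i j => (integrable_outer _ _ _).const_mul _
      rw [integral_finsetSum _ fun i _ => integrable_finsetSum _ fun j _ => hi i j]
      simp only [dotProduct, mulVec, of_apply, Finset.mul_sum, Pi.star_apply]
      refine Finset.sum_congr rfl fun i _ => ?_
      rw [integral_finsetSum _ fun j _ => hi i j]
      refine Finset.sum_congr rfl fun j _ => ?_
      rw [integral_const_mul]
      ring
    rw [h1, integral_complex_ofReal, Complex.zero_le_real]
    exact integral_nonneg fun p => by positivity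

/-- A matrix transform represented by `ν` restricts to a Stieltjes transform of a positive
matrix-valued measure. -/
theorem Represents.exists_matrixMeasure (h : Represents ν X) {k : ℕ} (e : Fin k → ι)
    (he : Function.Injective e) :
    ∃ μ : MatrixMeasure k, μ.IsPositive ∧ μ.eval Set.univ = 1 ∧
      μ.IsStieltjesTransform fun z => (X z).submatrix e e := by
  -- Integrate out the vector: the entries of `v vᴴ` serve as densities, pushed forward to the
  -- spectral coordinate.
  set μ : MatrixMeasure k := fun i j => (ν.withDensityᵥ (outer (e i) (e j))).map Prod.fst with hμ
  have heval : ∀ s, MeasurableSet s →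
      μ.eval s = Matrix.of fun i j => ∫ p in Prod.fst ⁻¹' s, outer (e i) (e j) p ∂ν := by
    intro s hs
    ext i j
    rw [MatrixMeasure.eval, of_apply, of_apply, hμ, VectorMeasure.map_apply _ measurable_fst hs,
      withDensityᵥ_apply (integrable_outer ν _ _) (measurable_fst hs)]
  refine ⟨μ, fun s hs => ?_, ?_, fun z i j => ?_⟩
  · rw [heval s hs]; exact posSemidef_setIntegral_outer e _
  · rw [heval _ MeasurableSet.univ]
    ext i j
    rw [of_apply, Set.preimage_univ, Measure.restrict_univ, h.mass, Matrix.one_apply,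
      Matrix.one_apply]
    simp only [he.eq_iff]
  · obtain ⟨C, hC⟩ := exists_norm_one_div_sub_le z.2
    obtain ⟨h1, h2⟩ := integral_withDensityᵥ_eq (integrable_outer ν (e i) (e j))
      (f := fun p => 1 / (((p.1 : ℝ) : ℂ) - (z : ℂ)))
      ((measurable_one_div_sub (z : ℂ)).comp measurable_fst).stronglyMeasurable (fun p => hC p.1)
    have hm : AEStronglyMeasurable (fun x : ℝ≥0 => 1 / (((x : ℝ) : ℂ) - (z : ℂ)))
        ((ν.withDensityᵥ (outer (e i) (e j))).variation.map Prod.fst) :=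
      (measurable_one_div_sub (z : ℂ)).aestronglyMeasurable
    refine ⟨VectorMeasure.Integrable.map hm h1, ?_⟩
    rw [hμ, VectorMeasure.integral_map measurable_fst hm h1, h2]
    exact h.transform z z.2 _ _

/-- Convex combinations of diagonal entries of a represented transform are Stieltjes transforms of
probability measures. -/
theorem Represents.sum_mem_stieltjesClass (h : Represents ν X) {c : ι → ℝ} (hc : ∀ s, 0 ≤ c s)
    (hc1 : ∑ s, c s = 1) :
    (fun z : cutPlane => ∑ s, (c s : ℂ) * X z s s) ∈ StieltjesClass := by
  -- This is the density of the sought scalar measure: nonnegative, with integral `∑ s, c s = 1`.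
  set d : VectorSpectrum ι → ℝ := fun p => ∑ s, c s * ‖p.2.1 s‖ ^ 2 with hd
  have hd0 : ∀ p, 0 ≤ d p := fun p => Finset.sum_nonneg fun s _ => mul_nonneg (hc s) (by positivity)
  have hdc : ∀ p, (d p : ℂ) = ∑ s, (c s : ℂ) * outer s s p := fun p => by
    rw [hd]; push_cast
    refine Finset.sum_congr rfl fun s _ => ?_
    rw [outer, ← Complex.mul_conj', Complex.star_def]
  have hdi : ∀ f : VectorSpectrum ι → ℂ, (∀ s, Integrable (fun p => outer s s p * f p) ν) →
      ∫ p, (d p : ℂ) * f p ∂ν = ∑ s, (c s : ℂ) * ∫ p, outer s s p * f p ∂ν := by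
    intro f hf
    simp only [hdc, Finset.sum_mul, mul_assoc]
    rw [integral_finsetSum _ fun s _ => (hf s).const_mul _]
    refine Finset.sum_congr rfl fun s _ => ?_
    rw [integral_const_mul]
  have hdm : Measurable d := by
    refine Continuous.measurable (continuous_finsetSum _ fun s _ => continuous_const.mul ?_)
    exact ((continuous_apply s).comp (continuous_subtype_val.comp continuous_snd)).norm.pow 2
  have hdint : Integrable d ν := by
    have : Integrable (fun p => ∑ s, (c s : ℂ) * outer s s p) ν :=
      integrable_finsetSum _ fun s _ => (integrable_outer ν s s).const_mul _
    simp only [← hdc] at this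
    simpa using this.re
  have hd1 : ∫ p, d p ∂ν = 1 := by
    have h1 := hdi 1 fun s => by simpa using! integrable_outer ν s s
    simp only [Pi.one_apply, mul_one, h.mass, Matrix.one_apply_eq] at h1
    rw [integral_complex_ofReal] at h1
    have h2 : ((∫ p, d p ∂ν : ℝ) : ℂ) = ((∑ s, c s : ℝ) : ℂ) := by rw [h1]; push_cast; rfl
    rw [← hc1]; exact_mod_cast h2
  refine ⟨(ν.withDensity fun p => ENNReal.ofReal (d p)).map Prod.fst, ⟨?_⟩, fun z => ?_⟩
  · rw [Measure.map_apply measurable_fst MeasurableSet.univ, Set.preimage_univ,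
      withDensity_apply _ MeasurableSet.univ, Measure.restrict_univ,
      ← ofReal_integral_eq_lintegral_ofReal hdint (ae_of_all _ hd0), hd1, ENNReal.ofReal_one]
  · rw [integral_map measurable_fst.aemeasurable
      (measurable_one_div_sub (z : ℂ)).aestronglyMeasurable,
      integral_withDensity_eq_integral_toReal_smul hdm.ennreal_ofReal
        (ae_of_all _ fun p => ENNReal.ofReal_lt_top)]
    simp only [ENNReal.toReal_ofReal (hd0 _), Complex.real_smul]
    rw [hdi _ fun s => integrable_mul_one_div_sub measurable_fst (integrable_outer ν s s) z.2]
    refine Finset.sum_congr rfl fun s _ => ?_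
    rw [h.transform z z.2]

theorem Represents.diag_mem_stieltjesClass (h : Represents ν X) (s : ι) :
    (fun z : cutPlane => X z s s) ∈ StieltjesClass := by
  have := h.sum_mem_stieltjesClass (c := Pi.single s 1)
    (fun t => by by_cases ht : t = s <;> simp [ht]) (by simp)
  convert this using 2 with z
  simp [Pi.single_apply, ite_mul, apply_ite Complex.ofReal]

theorem Represents.normalized_trace_mem_stieltjesClass (h : Represents ν X) {k : ℕ} (hk : 0 < k)
    (e : Fin k → ι) :
    (fun z : cutPlane => (1 / (k : ℂ)) * ((X z).submatrix e e).trace) ∈ StieltjesClass := by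
  have key : ∀ f : ι → ℂ, ∑ s, (((∑ i, if e i = s then 1 / (k : ℝ) else 0 : ℝ)) : ℂ) * f s =
      1 / (k : ℂ) * ∑ i, f (e i) := by
    intro f
    push_cast
    simp only [Finset.sum_mul]
    rw [Finset.sum_comm, Finset.mul_sum]
    refine Finset.sum_congr rfl fun i _ => ?_
    simp [ite_mul, apply_ite Complex.ofReal]
  have hk0 : (k : ℂ) ≠ 0 := by exact_mod_cast hk.ne'
  have := h.sum_mem_stieltjesClass (c := fun s => ∑ i, if e i = s then 1 / (k : ℝ) else 0)
    (fun s => Finset.sum_nonneg fun i _ => by positivity) (by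
      have h1 := key 1
      simp only [Pi.one_apply, mul_one, Finset.sum_const, Finset.card_univ, Fintype.card_fin,
        nsmul_eq_mul, one_div_mul_cancel hk0] at h1
      exact_mod_cast h1)
  convert this using 2 with z
  rw [key]
  rfl

end Representation

variable {N n : ℕ}

/-- Positions of the four diagonal blocks `T`, `T̃`, `Ψ`, `Ψ̃`. -/
abbrev BlockIndex (N n : ℕ) : Type := (Fin N ⊕ Fin n) ⊕ (Fin N ⊕ Fin n)

/-! ### The system as a fixed point equation -/

section SystemMap

/-- `(1/n) ∑ⱼ σᵢⱼ² yⱼ`. -/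
def rowMean (σ : Fin N → Fin n → ℝ) (y : Fin n → ℂ) (i : Fin N) : ℂ :=
  (1 / (n : ℂ)) * ∑ j, ((σ i j ^ 2 : ℝ) : ℂ) * y j

/-- `(1/n) ∑ᵢ σᵢⱼ² xᵢ`. -/
def colMean (σ : Fin N → Fin n → ℝ) (x : Fin N → ℂ) (j : Fin n) : ℂ :=
  (1 / (n : ℂ)) * ∑ i, ((σ i j ^ 2 : ℝ) : ℂ) * x i

theorem rowProfile_trace (σ : Fin N → Fin n → ℝ) (i : Fin N) (M : Matrix (Fin n) (Fin n) ℂ) :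
    (1 / (n : ℂ)) * (rowProfile σ i * M).trace = rowMean σ M.diag i := by
  rw [rowMean, rowProfile, trace]
  simp only [diag_apply, diagonal_mul]

theorem colProfile_trace (σ : Fin N → Fin n → ℝ) (j : Fin n) (M : Matrix (Fin N) (Fin N) ℂ) :
    (1 / (n : ℂ)) * (colProfile σ j * M).trace = colMean σ M.diag j := by
  rw [colMean, colProfile, trace]
  simp only [diag_apply, diagonal_mul]

/-- The linear map which turns the system of equations into
`X(z) (-z (1 + η (diag X(z)))) = 1` for `X = diag(T, T̃, Ψ, Ψ̃)`. -/
def systemMap (σ : Fin N → Fin n → ℝ) (A : Matrix (Fin N) (Fin n) ℝ) :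
    (BlockIndex N n → ℂ) →ₗ[ℂ] Matrix (BlockIndex N n) (BlockIndex N n) ℂ where
  -- The lower blocks of `-z (1 + η)` are to be `Ψ⁻¹` and `Ψ̃⁻¹`; the upper ones add the terms in
  -- `A`, giving the inverses of `T` and `T̃`.
  toFun x := fromBlocks
    (fromBlocks
      (diagonal (rowMean σ fun j => x (.inl (.inr j))) +
        toComplex A * diagonal (fun j => x (.inr (.inr j))) * (toComplex A)ᵀ) 0 0
      (diagonal (colMean σ fun i => x (.inl (.inl i))) +
        (toComplex A)ᵀ * diagonal (fun i => x (.inr (.inl i))) * toComplex A)) 0 0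
    (fromBlocks (diagonal (rowMean σ fun j => x (.inl (.inr j)))) 0 0
      (diagonal (colMean σ fun i => x (.inl (.inl i)))))
  map_add' x y := by
    have h1 : ∀ f g : Fin n → ℂ, rowMean σ (fun j => f j + g j) = rowMean σ f + rowMean σ g := by
      intro f g; ext i; simp [rowMean, mul_add, Finset.sum_add_distrib]
    have h2 : ∀ f g : Fin N → ℂ, colMean σ (fun j => f j + g j) = colMean σ f + colMean σ g := by
      intro f g; ext i; simp [colMean, mul_add, Finset.sum_add_distrib]
    simp only [Pi.add_apply, h1, h2, fromBlocks_add, add_zero]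
    simp only [← Matrix.diagonal_add, Pi.add_def, Matrix.mul_add, Matrix.add_mul]
    congr 2 <;> abel
  map_smul' c x := by
    have h1 : ∀ f : Fin n → ℂ, rowMean σ (fun j => c * f j) = c • rowMean σ f := by
      intro f; ext i
      simp only [rowMean, Pi.smul_apply, smul_eq_mul, Finset.mul_sum]
      exact Finset.sum_congr rfl fun j _ => by ring
    have h2 : ∀ f : Fin N → ℂ, colMean σ (fun j => c * f j) = c • colMean σ f := by
      intro f; ext i
      simp only [colMean, Pi.smul_apply, smul_eq_mul, Finset.mul_sum]
      exact Finset.sum_congr rfl fun j _ => by ring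
    have h3 : ∀ {k : ℕ} (f : Fin k → ℂ), diagonal (fun j => c * f j) = c • diagonal f :=
      fun f => diagonal_smul c f
    simp only [Pi.smul_apply, smul_eq_mul, h1, h2, h3, diagonal_smul, RingHom.id_apply,
      fromBlocks_smul, smul_zero, smul_add, Matrix.mul_smul, Matrix.smul_mul]

theorem toComplex_conjTranspose (A : Matrix (Fin N) (Fin n) ℝ) :
    (toComplex A)ᴴ = (toComplex A)ᵀ := by
  ext i j; simp [toComplex]

theorem _root_.Matrix.PosSemidef.fromBlocks_zero {l m : Type} [Fintype l] [Fintype m]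
    [DecidableEq l] [DecidableEq m] {P : Matrix l l ℂ} {Q : Matrix m m ℂ} (hP : P.PosSemidef)
    (hQ : Q.PosSemidef) : (fromBlocks P 0 0 Q).PosSemidef := by
  obtain ⟨L, rfl⟩ := hP.exists_eq_mul_conjTranspose
  obtain ⟨M, rfl⟩ := hQ.exists_eq_mul_conjTranspose
  have : fromBlocks (L * Lᴴ) 0 0 (M * Mᴴ) = fromBlocks L 0 0 M * (fromBlocks L 0 0 M)ᴴ := by
    simp [fromBlocks_conjTranspose, fromBlocks_multiply]
  rw [this]
  exact posSemidef_self_mul_conjTranspose _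

/-- The weights `σ i j ^ 2` are nonnegative, and since `A` is real its transpose is its adjoint, so
the terms in `A` are congruences of nonnegative diagonal matrices. -/
theorem isPositiveMap_systemMap (σ : Fin N → Fin n → ℝ) (A : Matrix (Fin N) (Fin n) ℝ) :
    IsPositiveMap (systemMap σ A) := by
  intro x hx
  have hn : (0 : ℂ) ≤ 1 / (n : ℂ) := by
    rw [show (1 / (n : ℂ)) = ((1 / n : ℝ) : ℂ) by push_cast; rfl, Complex.zero_le_real]
    positivity
  have hr : (diagonal (rowMean σ fun j => x (.inl (.inr j)))).PosSemidef :=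
    PosSemidef.diagonal fun i => mul_nonneg hn (Finset.sum_nonneg fun j _ =>
      mul_nonneg (Complex.zero_le_real.mpr (sq_nonneg _)) (hx _))
  have hc : (diagonal (colMean σ fun i => x (.inl (.inl i)))).PosSemidef :=
    PosSemidef.diagonal fun j => mul_nonneg hn (Finset.sum_nonneg fun i _ =>
      mul_nonneg (Complex.zero_le_real.mpr (sq_nonneg _)) (hx _))
  refine PosSemidef.fromBlocks_zero (PosSemidef.fromBlocks_zero (hr.add ?_) (hc.add ?_))
    (PosSemidef.fromBlocks_zero hr hc)
  · rw [← toComplex_conjTranspose]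
    exact (PosSemidef.diagonal fun j => hx (.inr (.inr j))).mul_mul_conjTranspose_same _
  · rw [← toComplex_conjTranspose]
    exact (PosSemidef.diagonal fun i => hx (.inr (.inl i))).conjTranspose_mul_mul_same _

/-- The matrix `diag(T, T̃, Ψ, Ψ̃)`. -/
def blockMatrix (T : Matrix (Fin N) (Fin N) ℂ) (S : Matrix (Fin n) (Fin n) ℂ) (f : Fin N → ℂ)
    (g : Fin n → ℂ) : Matrix (BlockIndex N n) (BlockIndex N n) ℂ :=
  fromBlocks (fromBlocks T 0 0 S) 0 0 (fromBlocks (diagonal f) 0 0 (diagonal g))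

/-- `hf` and `hg` say that `-z (1 + r)` and `-z (1 + c)`, with `r`, `c` the means, invert `f` and
`g`. Both directions between system and fixed point equation rest on this formula. -/
theorem neg_smul_one_add_systemMap (σ : Fin N → Fin n → ℝ) (A : Matrix (Fin N) (Fin n) ℝ) (z : ℂ)
    (x : BlockIndex N n → ℂ) (f : Fin N → ℂ) (g : Fin n → ℂ)
    (hf : ∀ i, f i * (-(z * (1 + rowMean σ (fun j => x (.inl (.inr j))) i))) = 1)
    (hg : ∀ j, g j * (-(z * (1 + colMean σ (fun i => x (.inl (.inl i))) j))) = 1)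
    (hxf : ∀ i, x (.inr (.inl i)) = f i) (hxg : ∀ j, x (.inr (.inr j)) = g j) :
    (-z) • (1 + systemMap σ A x) = blockMatrix
      ((diagonal f)⁻¹ - z • (toComplex A * diagonal g * (toComplex A)ᵀ))
      ((diagonal g)⁻¹ - z • ((toComplex A)ᵀ * diagonal f * toComplex A))
      (fun i => (f i)⁻¹) (fun j => (g j)⁻¹) := by
  have hdiag : ∀ {k : ℕ} (h r : Fin k → ℂ), (∀ i, h i * (-(z * (1 + r i))) = 1) →
      (-z) • (1 + diagonal r) = diagonal fun i => (h i)⁻¹ := by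
    intro k h r hr
    rw [← diagonal_one, diagonal_add, ← diagonal_smul]
    congr 1; ext i
    rw [← eq_inv_of_mul_eq_one_right (hr i)]
    simp
  have hinv : ∀ {k : ℕ} (h r : Fin k → ℂ), (∀ i, h i * (-(z * (1 + r i))) = 1) →
      (diagonal h)⁻¹ = diagonal fun i => (h i)⁻¹ := by
    intro k h r hr
    apply inv_eq_right_inv
    rw [diagonal_mul_diagonal, ← diagonal_one]
    congr 1; ext i
    exact mul_inv_cancel₀ (left_ne_zero_of_mul_eq_one (hr i))
  rw [hinv _ _ hf, hinv _ _ hg, blockMatrix, ← hdiag _ _ hf, ← hdiag _ _ hg]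
  simp only [systemMap, LinearMap.coe_mk, AddHom.coe_mk, hxf, hxg]
  rw [← fromBlocks_one (l := Fin N ⊕ Fin n), ← fromBlocks_one (l := Fin N) (m := Fin n)]
  simp only [fromBlocks_add, fromBlocks_smul, add_zero, smul_zero, smul_add, neg_smul,
    sub_eq_add_neg, add_assoc, fromBlocks_neg, neg_add, neg_zero]

/-- A solution of the fixed point equation yields a solution of the system at the point `z`. -/
theorem system_of_fixedPoint (σ : Fin N → Fin n → ℝ) (A : Matrix (Fin N) (Fin n) ℝ) (z : cutPlane)
    (X : Matrix (BlockIndex N n) (BlockIndex N n) ℂ)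
    (hX : X * ((-(z : ℂ)) • (1 + systemMap σ A X.diag)) = 1)
    (ψ : Fin N → cutPlane → ℂ) (ψt : Fin n → cutPlane → ℂ)
    (hψ : ∀ i, ψ i z = X (.inr (.inl i)) (.inr (.inl i)))
    (hψt : ∀ j, ψt j z = X (.inr (.inr j)) (.inr (.inr j))) :
    preT A ψ ψt z * X.submatrix (.inl ∘ .inl) (.inl ∘ .inl) = 1 ∧
    preT Aᵀ ψt ψ z * X.submatrix (.inl ∘ .inr) (.inl ∘ .inr) = 1 ∧
    (∀ i, ψ i z * -rowDenom σ A ψ ψt i z = 1) ∧ ∀ j, ψt j z * -colDenom σ A ψ ψt j z = 1 := by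
  set r := rowMean σ fun j => X.diag (.inl (.inr j)) with hr
  set c := colMean σ fun i => X.diag (.inl (.inl i)) with hc
  -- With the block diagonal factor on the left, each block equation can be read off without knowing
  -- that `X` is block diagonal.
  have h0 := mul_eq_one_comm.mp hX
  have key : ∀ a b, ∑ k, ((-(z : ℂ)) • (1 + systemMap σ A X.diag)) a k * X k b =
      (1 : Matrix (BlockIndex N n) (BlockIndex N n) ℂ) a b := fun a b =>
    congrFun (congrFun h0 a) b
  have hf : ∀ i, ψ i z * (-((z : ℂ) * (1 + r i))) = 1 := fun i => by
    have hk := key (.inr (.inl i)) (.inr (.inl i))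
    have e : ∀ x, ((-(z : ℂ)) • (1 + systemMap σ A X.diag)) (.inr (.inl i)) (.inr (.inl x)) =
        if i = x then -((z : ℂ) * (1 + r i)) else 0 := fun x => by
      by_cases hx : i = x <;> simp [systemMap, hx, hr]
    have e' : ∀ x, ((-(z : ℂ)) • (1 + systemMap σ A X.diag)) (.inr (.inl i)) (.inr (.inr x)) = 0 :=
      fun x => by simp [systemMap]
    have e'' : ∀ x, ((-(z : ℂ)) • (1 + systemMap σ A X.diag)) (.inr (.inl i)) (.inl x) = 0 :=
      fun x => by simp [systemMap]
    simp only [Fintype.sum_sum_type (α₁ := Fin N ⊕ Fin n), Fintype.sum_sum_type (α₁ := Fin N)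
      (f := fun x => ((-(z : ℂ)) • (1 + systemMap σ A X.diag)) (.inr (.inl i)) (.inr x) *
        X (.inr x) (.inr (.inl i))), e, e', e'', ite_mul, zero_mul, Finset.sum_const_zero,
      Finset.sum_ite_eq, Finset.mem_univ, if_true, add_zero, zero_add, Matrix.one_apply_eq] at hk
    rw [hψ, mul_comm]
    exact hk
  have hg : ∀ j, ψt j z * (-((z : ℂ) * (1 + c j))) = 1 := fun j => by
    have hk := key (.inr (.inr j)) (.inr (.inr j))
    have e : ∀ x, ((-(z : ℂ)) • (1 + systemMap σ A X.diag)) (.inr (.inr j)) (.inr (.inr x)) =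
        if j = x then -((z : ℂ) * (1 + c j)) else 0 := fun x => by
      by_cases hx : j = x <;> simp [systemMap, hx, hc]
    have e' : ∀ x, ((-(z : ℂ)) • (1 + systemMap σ A X.diag)) (.inr (.inr j)) (.inr (.inl x)) = 0 :=
      fun x => by simp [systemMap]
    have e'' : ∀ x, ((-(z : ℂ)) • (1 + systemMap σ A X.diag)) (.inr (.inr j)) (.inl x) = 0 :=
      fun x => by simp [systemMap]
    simp only [Fintype.sum_sum_type (α₁ := Fin N ⊕ Fin n), Fintype.sum_sum_type (α₁ := Fin N)
      (f := fun x => ((-(z : ℂ)) • (1 + systemMap σ A X.diag)) (.inr (.inr j)) (.inr x) *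
        X (.inr x) (.inr (.inr j))), e, e', e'', ite_mul, zero_mul, Finset.sum_const_zero,
      Finset.sum_ite_eq, Finset.mem_univ, if_true, zero_add, Matrix.one_apply_eq] at hk
    rw [hψt, mul_comm]
    exact hk
  have hblock := neg_smul_one_add_systemMap σ A z X.diag (fun i => ψ i z) (fun j => ψt j z) hf hg
    (fun i => (hψ i).symm) (fun j => (hψt j).symm)
  rw [hblock] at h0
  have hT : preT A ψ ψt z * X.submatrix (.inl ∘ .inl) (.inl ∘ .inl) = 1 := by
    ext i j
    have := congrFun (congrFun h0 (.inl (.inl i))) (.inl (.inl j))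
    rw [Matrix.mul_apply] at this ⊢
    simpa [Fintype.sum_sum_type, blockMatrix, Matrix.one_apply] using! this
  have hTt : preT Aᵀ ψt ψ z * X.submatrix (.inl ∘ .inr) (.inl ∘ .inr) = 1 := by
    ext i j
    have := congrFun (congrFun h0 (.inl (.inr i))) (.inl (.inr j))
    rw [Matrix.mul_apply] at this ⊢
    simpa [Fintype.sum_sum_type, blockMatrix, Matrix.one_apply] using! this
  refine ⟨hT, hTt, fun i => ?_, fun j => ?_⟩
  · rw [rowDenom, rowProfile_trace, matTt, inv_eq_right_inv hTt]
    exact hf i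
  · rw [colDenom, colProfile_trace, matT, inv_eq_right_inv hT]
    exact hg j

/-- A solution of the system at the point `z` yields a solution of the fixed point equation. -/
theorem fixedPoint_of_system (σ : Fin N → Fin n → ℝ) (A : Matrix (Fin N) (Fin n) ℝ) (z : cutPlane)
    (ψ : Fin N → cutPlane → ℂ) (ψt : Fin n → cutPlane → ℂ)
    (hψ : ∀ i, ψ i z * -rowDenom σ A ψ ψt i z = 1)
    (hψt : ∀ j, ψt j z * -colDenom σ A ψ ψt j z = 1)
    (hT : IsUnit (preT A ψ ψt z).det) (hTt : IsUnit (preT Aᵀ ψt ψ z).det) :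
    blockMatrix (matT A ψ ψt z) (matTt A ψ ψt z) (fun i => ψ i z) (fun j => ψt j z) *
      ((-(z : ℂ)) • (1 + systemMap σ A (blockMatrix (matT A ψ ψt z) (matTt A ψ ψt z)
        (fun i => ψ i z) (fun j => ψt j z)).diag)) = 1 := by
  rw [neg_smul_one_add_systemMap σ A z _ (fun i => ψ i z) (fun j => ψt j z)
    (fun i => by
      have := hψ i
      rwa [rowDenom, rowProfile_trace] at this)
    (fun j => by
      have := hψt j
      rwa [colDenom, colProfile_trace] at this)
    (fun i => by simp [blockMatrix]) (fun j => by simp [blockMatrix])]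
  have h1 : matT A ψ ψt z * ((diagonal fun i => ψ i z)⁻¹ -
      (z : ℂ) • (toComplex A * diagonal (fun j => ψt j z) * (toComplex A)ᵀ)) = 1 :=
    nonsing_inv_mul _ hT
  have h2 : matTt A ψ ψt z * ((diagonal fun j => ψt j z)⁻¹ -
      (z : ℂ) • ((toComplex A)ᵀ * diagonal (fun i => ψ i z) * toComplex A)) = 1 :=
    nonsing_inv_mul _ hTt
  have h3 : ∀ {k : ℕ} (h : Fin k → ℂ), (∀ i, h i ≠ 0) →
      diagonal h * diagonal (fun i => (h i)⁻¹) = 1 := fun h h0 => by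
    rw [diagonal_mul_diagonal, ← diagonal_one]
    congr 1; ext i
    exact mul_inv_cancel₀ (h0 i)
  simp only [blockMatrix, fromBlocks_multiply, h1, h2, Matrix.mul_zero, Matrix.zero_mul, add_zero,
    zero_add, h3 _ fun i => left_ne_zero_of_mul_eq_one (hψ i),
    h3 _ fun j => left_ne_zero_of_mul_eq_one (hψt j), fromBlocks_one]

end SystemMap

/-! ### Uniqueness from the behaviour near `-∞` -/

section Uniqueness

/-- The point `-t` of the cut plane, for `t ≥ 1`. -/
def negPoint (t : ℝ) : cutPlane :=
  ⟨-((max t 1 : ℝ) : ℂ), neg_ofReal_mem_cutPlane (lt_max_of_lt_right one_pos)⟩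

theorem coe_negPoint {t : ℝ} (ht : 1 ≤ t) : (negPoint t : ℂ) = -(t : ℂ) := by
  simp only [negPoint, max_eq_left ht]

theorem ne_zero_and_norm_le_negPoint {f : cutPlane → ℂ} (hf : f ∈ StieltjesClass) {t : ℝ}
    (ht : 1 ≤ t) : f (negPoint t) ≠ 0 ∧ ‖f (negPoint t)‖ ≤ 1 / t := by
  have := ne_zero_and_norm_le_of_mem_stieltjesClass hf (one_pos.trans_le ht)
  have e : negPoint t = ⟨-(t : ℂ), neg_ofReal_mem_cutPlane (one_pos.trans_le ht)⟩ :=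
    Subtype.ext (coe_negPoint ht)
  rwa [e]

theorem tendsto_negPoint_zero {f : cutPlane → ℂ} (hf : f ∈ StieltjesClass) :
    Tendsto (fun t => f (negPoint t)) atTop (𝓝 0) := by
  refine squeeze_zero_norm' (a := fun t : ℝ => 1 / t) ?_ ?_
  · filter_upwards [eventually_ge_atTop 1] with t ht
    exact (ne_zero_and_norm_le_negPoint hf ht).2
  · simpa using tendsto_inv_atTop_zero (𝕜 := ℝ)

theorem tendsto_matrix_of_forall {α l m : Type*} {F : Filter α} {f : α → Matrix l m ℂ}
    {M : Matrix l m ℂ} (h : ∀ i j, Tendsto (fun t => f t i j) F (𝓝 (M i j))) :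
    Tendsto f F (𝓝 M) :=
  tendsto_pi_nhds.mpr fun i => tendsto_pi_nhds.mpr fun j => h i j

theorem tendsto_diagFun_negPoint {k : ℕ} {f : Fin k → cutPlane → ℂ}
    (hf : ∀ i, f i ∈ StieltjesClass) :
    Tendsto (fun t => diagFun f (negPoint t)) atTop (𝓝 0) := by
  refine tendsto_matrix_of_forall fun i j => ?_
  by_cases h : i = j
  · subst h; simpa [diagFun] using tendsto_negPoint_zero (hf i)
  · simp [diagFun, h]

/-- `T(-t)` exists for large `t` and tends to `0` as `t → ∞`. -/
theorem eventually_isUnit_preT_and_tendsto_matT (A : Matrix (Fin N) (Fin n) ℝ)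
    {ψ : Fin N → cutPlane → ℂ} {ψt : Fin n → cutPlane → ℂ} (hψ : ∀ i, ψ i ∈ StieltjesClass)
    (hψt : ∀ j, ψt j ∈ StieltjesClass) :
    (∀ᶠ t in atTop, IsUnit (preT A ψ ψt (negPoint t)).det) ∧
      Tendsto (fun t => matT A ψ ψt (negPoint t)) atTop (𝓝 0) := by
  -- Factor `preT = Ψ⁻¹ E` with `E = 1 - z Ψ A Ψ̃ Aᵀ`. As `|z ψ_i| ≤ 1` and `Ψ̃ → 0`, `E → 1`; so
  -- `E` is eventually invertible and `T = E⁻¹ Ψ → 0`.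
  set E : ℝ → Matrix (Fin N) (Fin N) ℂ := fun t => 1 - (negPoint t : ℂ) •
    (diagFun ψ (negPoint t) * (toComplex A * diagFun ψt (negPoint t) * (toComplex A)ᵀ)) with hE
  have hfac : ∀ᶠ t in atTop, preT A ψ ψt (negPoint t) = (diagFun ψ (negPoint t))⁻¹ * E t ∧
      IsUnit (diagFun ψ (negPoint t)).det := by
    filter_upwards [eventually_ge_atTop 1] with t ht
    have hu : IsUnit (diagFun ψ (negPoint t)).det := by
      rw [diagFun, det_diagonal, isUnit_iff_ne_zero]
      exact Finset.prod_ne_zero_iff.mpr fun i _ => (ne_zero_and_norm_le_negPoint (hψ i) ht).1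
    refine ⟨?_, hu⟩
    rw [hE, preT, Matrix.mul_sub, Matrix.mul_one, Matrix.mul_smul,
      nonsing_inv_mul_cancel_left _ _ hu]
  have hB : Tendsto (fun t => toComplex A * diagFun ψt (negPoint t) * (toComplex A)ᵀ) atTop
      (𝓝 0) := by
    have h1 : Tendsto (fun t => diagFun ψt (negPoint t)) atTop (𝓝 0) :=
      tendsto_diagFun_negPoint hψt
    have h2 : Continuous fun M : Matrix (Fin n) (Fin n) ℂ => toComplex A * M * (toComplex A)ᵀ := by
      fun_prop
    have := (h2.tendsto 0).comp h1
    simpa using! this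
  have hE1 : Tendsto E atTop (𝓝 1) := by
    have h1 : Tendsto (fun t => (negPoint t : ℂ) •
        (diagFun ψ (negPoint t) * (toComplex A * diagFun ψt (negPoint t) * (toComplex A)ᵀ)))
        atTop (𝓝 0) := by
      refine tendsto_matrix_of_forall fun i j => ?_
      have hij : Tendsto (fun t =>
          ‖(toComplex A * diagFun ψt (negPoint t) * (toComplex A)ᵀ) i j‖) atTop (𝓝 0) := by
        have := ((continuous_apply_apply i j).tendsto (0 : Matrix (Fin N) (Fin N) ℂ)).comp hB
        simpa using! this.norm
      refine squeeze_zero_norm' ?_ hij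
      filter_upwards [eventually_ge_atTop 1] with t ht
      have h0 : (0 : ℝ) < t := one_pos.trans_le ht
      rw [Matrix.smul_apply, diagFun, diagonal_mul, smul_eq_mul, norm_mul, norm_mul,
        coe_negPoint ht, norm_neg, Complex.norm_real, Real.norm_of_nonneg h0.le, ← mul_assoc]
      refine mul_le_of_le_one_left (norm_nonneg _) ?_
      calc t * ‖ψ i (negPoint t)‖ ≤ t * (1 / t) := by
            gcongr; exact (ne_zero_and_norm_le_negPoint (hψ i) ht).2
        _ = 1 := by field_simp
    simpa using! tendsto_const_nhds.sub h1
  have hdet : Tendsto (fun t => (E t).det) atTop (𝓝 1) := by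
    have := ((Continuous.matrix_det continuous_id).tendsto (1 : Matrix (Fin N) (Fin N) ℂ)).comp hE1
    simpa using! this
  have hEu : ∀ᶠ t in atTop, IsUnit (E t).det := by
    filter_upwards [hdet.eventually_ne one_ne_zero] with t ht using isUnit_iff_ne_zero.mpr ht
  refine ⟨?_, ?_⟩
  · filter_upwards [hfac, hEu] with t h1 h2
    rw [h1.1, det_mul]
    exact (isUnit_nonsing_inv_det _ h1.2).mul h2
  · have hinv : Tendsto (fun t => (E t)⁻¹) atTop (𝓝 1) := by
      have h1 : Tendsto (fun t => (E t).adjugate) atTop (𝓝 1) := by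
        have := ((Continuous.matrix_adjugate continuous_id).tendsto
          (1 : Matrix (Fin N) (Fin N) ℂ)).comp hE1
        simpa using! this
      have h2 := (hdet.inv₀ one_ne_zero).smul h1
      rw [inv_one, one_smul] at h2
      refine h2.congr fun t => ?_
      rw [inv_def, Ring.inverse_eq_inv']
    have hψ0 : Tendsto (fun t => diagFun ψ (negPoint t)) atTop (𝓝 0) :=
      tendsto_diagFun_negPoint hψ
    have h3 := hinv.mul hψ0
    rw [mul_zero] at h3
    refine h3.congr' ?_
    filter_upwards [hfac] with t h1
    rw [matT, h1.1, Matrix.mul_inv_rev, nonsing_inv_nonsing_inv _ h1.2]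

/-- A zero denominator would make the quotient 0 by convention, but members of the class do not
vanish on the negative axis. -/
theorem IsSolution.mul_neg_denom_eq_one {σ : Fin N → Fin n → ℝ} {A : Matrix (Fin N) (Fin n) ℝ}
    {ψ : Fin N → cutPlane → ℂ} {ψt : Fin n → cutPlane → ℂ} (h : IsSolution σ A ψ ψt) {t : ℝ}
    (ht : 1 ≤ t) :
    (∀ i, ψ i (negPoint t) * -rowDenom σ A ψ ψt i (negPoint t) = 1) ∧
      ∀ j, ψt j (negPoint t) * -colDenom σ A ψ ψt j (negPoint t) = 1 := by
  have key : ∀ a b : ℂ, a ≠ 0 → a = -1 / b → a * -b = 1 := by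
    rintro a b ha rfl
    have hb : b ≠ 0 := fun hb => ha (by rw [hb, div_zero])
    field_simp
  exact ⟨fun i => key _ _ (ne_zero_and_norm_le_negPoint (h.mem_row i) ht).1 (h.eq_row i _),
    fun j => key _ _ (ne_zero_and_norm_le_negPoint (h.mem_col j) ht).1 (h.eq_col j _)⟩

/-- No invertibility is assumed: at points where an inverse fails to exist its conventional value is
never used, since only `-t` with `t` large enters, where the inverses exist. -/
theorem IsSolution.unique (hN : 0 < N) {σ : Fin N → Fin n → ℝ} {A : Matrix (Fin N) (Fin n) ℝ}
    {ψ ψ' : Fin N → cutPlane → ℂ} {ψt ψt' : Fin n → cutPlane → ℂ} (h : IsSolution σ A ψ ψt)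
    (h' : IsSolution σ A ψ' ψt') : ψ = ψ' ∧ ψt = ψt' := by
  have : Nonempty (BlockIndex N n) := ⟨.inl (.inl ⟨0, hN⟩)⟩
  have key : ∀ {ψ : Fin N → cutPlane → ℂ} {ψt : Fin n → cutPlane → ℂ}, IsSolution σ A ψ ψt →
      (∀ᶠ t in atTop, blockMatrix (matT A ψ ψt (negPoint t)) (matTt A ψ ψt (negPoint t))
        (fun i => ψ i (negPoint t)) (fun j => ψt j (negPoint t)) * ((t : ℂ) • (1 + systemMap σ A
          (blockMatrix (matT A ψ ψt (negPoint t)) (matTt A ψ ψt (negPoint t))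
          (fun i => ψ i (negPoint t)) (fun j => ψt j (negPoint t))).diag)) = 1) ∧
      Tendsto (fun t => blockMatrix (matT A ψ ψt (negPoint t)) (matTt A ψ ψt (negPoint t))
        (fun i => ψ i (negPoint t)) (fun j => ψt j (negPoint t))) atTop (𝓝 0) := by
    intro ψ ψt h
    obtain ⟨h1, h2⟩ := eventually_isUnit_preT_and_tendsto_matT A h.mem_row h.mem_col
    obtain ⟨h3, h4⟩ := eventually_isUnit_preT_and_tendsto_matT Aᵀ h.mem_col h.mem_row
    constructor
    · filter_upwards [h1, h3, eventually_ge_atTop 1] with t h5 h6 ht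
      have := fixedPoint_of_system σ A (negPoint t) ψ ψt (h.mul_neg_denom_eq_one ht).1
        (h.mul_neg_denom_eq_one ht).2 h5 h6
      rwa [coe_negPoint ht, neg_neg] at this
    · refine tendsto_matrix_of_forall fun a b => ?_
      have e1 := fun i j =>
        ((continuous_apply_apply i j).tendsto (0 : Matrix (Fin N) (Fin N) ℂ)).comp h2
      have e2 := fun i j =>
        ((continuous_apply_apply i j).tendsto (0 : Matrix (Fin n) (Fin n) ℂ)).comp h4
      rcases a with (a | a) | (a | a) <;> rcases b with (b | b) | (b | b) <;>
        simp only [blockMatrix, fromBlocks_apply₁₁, fromBlocks_apply₁₂, fromBlocks_apply₂₁,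
          fromBlocks_apply₂₂, Matrix.zero_apply, tendsto_const_nhds_iff]
      · exact e1 a b
      · exact e2 a b
      · by_cases hab : a = b
        · subst hab; simpa using tendsto_negPoint_zero (h.mem_row a)
        · simp [hab]
      · by_cases hab : a = b
        · subst hab; simpa using tendsto_negPoint_zero (h.mem_col a)
        · simp [hab]
  have hev := eventually_eq_of_fixedPoint (systemMap σ A) _ _ (key h).1 (key h').1 (key h).2
    (key h').2
  have ext : ∀ {f g : cutPlane → ℂ}, f ∈ StieltjesClass → g ∈ StieltjesClass →
      (∀ᶠ t in atTop, f (negPoint t) = g (negPoint t)) → f = g := by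
    intro f g hf hg hfg
    obtain ⟨F, hF, hF'⟩ := exists_differentiableOn_of_mem_stieltjesClass hf
    obtain ⟨G, hG, hG'⟩ := exists_differentiableOn_of_mem_stieltjesClass hg
    have := eqOn_cutPlane hF hG (by
      filter_upwards [hfg, eventually_ge_atTop 1] with t h1 ht
      rwa [hF', hG', coe_negPoint ht] at h1)
    funext z
    rw [hF', hG', this z.2]
  constructor
  · funext i
    refine ext (h.mem_row i) (h'.mem_row i) ?_
    filter_upwards [hev] with t ht
    simpa [blockMatrix] using congrFun (congrFun ht (.inr (.inl i))) (.inr (.inl i))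
  · funext j
    refine ext (h.mem_col j) (h'.mem_col j) ?_
    filter_upwards [hev] with t ht
    simpa [blockMatrix] using congrFun (congrFun ht (.inr (.inr j))) (.inr (.inr j))

end Uniqueness

end

end DetEquiv

/-! ### The theorem -/

open DetEquiv in
theorem theorem2p4 (N n : ℕ) (hN : 0 < N) (hn : 0 < n)
    (σ : Fin N → Fin n → ℝ) (A : Matrix (Fin N) (Fin n) ℝ) :
    (∃! p : (Fin N → DetEquiv.cutPlane → ℂ) × (Fin n → DetEquiv.cutPlane → ℂ),
      DetEquiv.IsSolution σ A p.1 p.2) ∧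
    ∀ (ψ : Fin N → DetEquiv.cutPlane → ℂ) (ψt : Fin n → DetEquiv.cutPlane → ℂ),
      DetEquiv.IsSolution σ A ψ ψt →
        DetEquiv.IsWellDefined σ A ψ ψt ∧
        (∃ (μ : DetEquiv.MatrixMeasure N) (μt : DetEquiv.MatrixMeasure n),
          μ.IsPositive ∧ μt.IsPositive ∧
          μ.eval Set.univ = 1 ∧ μt.eval Set.univ = 1 ∧
          μ.IsStieltjesTransform (DetEquiv.matT A ψ ψt) ∧
          μt.IsStieltjesTransform (DetEquiv.matTt A ψ ψt)) ∧
        (fun z => (1 / (N : ℂ)) * (DetEquiv.matT A ψ ψt z).trace) ∈ DetEquiv.StieltjesClass ∧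
        (fun z => (1 / (n : ℂ)) * (DetEquiv.matTt A ψ ψt z).trace) ∈ DetEquiv.StieltjesClass := by
  have : Nonempty (BlockIndex N n) := ⟨.inl (.inl ⟨0, hN⟩)⟩
  obtain ⟨ν, X, hrep, hfix⟩ := exists_represents_fixedPoint (isPositiveMap_systemMap σ A)
  set ψ₀ : Fin N → cutPlane → ℂ := fun i z => X z (.inr (.inl i)) (.inr (.inl i)) with hψ₀
  set ψt₀ : Fin n → cutPlane → ℂ := fun j z => X z (.inr (.inr j)) (.inr (.inr j)) with hψt₀
  have hsys := fun z : cutPlane => system_of_fixedPoint σ A z (X z) (hfix z z.2) ψ₀ ψt₀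
    (fun _ => rfl) (fun _ => rfl)
  have hT : ∀ z : cutPlane, matT A ψ₀ ψt₀ z = (X z).submatrix (.inl ∘ .inl) (.inl ∘ .inl) :=
    fun z => Matrix.inv_eq_right_inv (hsys z).1
  have hTt : ∀ z : cutPlane, matTt A ψ₀ ψt₀ z = (X z).submatrix (.inl ∘ .inr) (.inl ∘ .inr) :=
    fun z => Matrix.inv_eq_right_inv (hsys z).2.1
  have key : ∀ a b : ℂ, a * -b = 1 → a = -1 / b := by
    intro a b hab
    have hb : b ≠ 0 := by rintro rfl; simp at hab
    rw [eq_div_iff hb]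
    linear_combination -hab
  have hsol : IsSolution σ A ψ₀ ψt₀ :=
    { mem_row := fun i => hrep.diag_mem_stieltjesClass _
      mem_col := fun j => hrep.diag_mem_stieltjesClass _
      eq_row := fun i z => key _ _ ((hsys z).2.2.1 i)
      eq_col := fun j z => key _ _ ((hsys z).2.2.2 j) }
  refine ⟨⟨(ψ₀, ψt₀), hsol, fun p hp => ?_⟩, fun ψ ψt h => ?_⟩
  · obtain ⟨h1, h2⟩ := IsSolution.unique hN hp hsol
    exact Prod.ext h1 h2
  -- By uniqueness an arbitrary solution is the one built from `X`, so its inverses and measures are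
  -- those of the blocks of `X`.
  obtain ⟨rfl, rfl⟩ := IsSolution.unique hN h hsol
  refine ⟨?_, ?_, ?_, ?_⟩
  · exact
      { row_ne := fun i z => left_ne_zero_of_mul_eq_one ((hsys z).2.2.1 i)
        col_ne := fun j z => left_ne_zero_of_mul_eq_one ((hsys z).2.2.2 j)
        unit_T := fun z => Matrix.isUnit_det_of_right_inverse (hsys z).1
        unit_Tt := fun z => Matrix.isUnit_det_of_right_inverse (hsys z).2.1
        rowDenom_ne := fun i z =>
          neg_ne_zero.mp (right_ne_zero_of_mul_eq_one ((hsys z).2.2.1 i))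
        colDenom_ne := fun j z =>
          neg_ne_zero.mp (right_ne_zero_of_mul_eq_one ((hsys z).2.2.2 j)) }
  · obtain ⟨μ, h1, h2, h3⟩ := hrep.exists_matrixMeasure (.inl ∘ .inl : Fin N → BlockIndex N n)
      (Sum.inl_injective.comp Sum.inl_injective)
    obtain ⟨μt, h4, h5, h6⟩ := hrep.exists_matrixMeasure (.inl ∘ .inr : Fin n → BlockIndex N n)
      (Sum.inl_injective.comp Sum.inr_injective)
    refine ⟨μ, μt, h1, h4, h2, h5, ?_, ?_⟩
    · rwa [funext hT]
    · rwa [funext hTt]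
  · simp only [hT]
    exact hrep.normalized_trace_mem_stieltjesClass hN _
  · simp only [hTt]
    exact hrep.normalized_trace_mem_stieltjesClass hn _
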